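/- Let $K$ be a finite abstract simplicial complex with vertex set $I$ (every $\{i\}$, $i\in I$, is a simplex, and $\emptyset$ is counted as a simplex). Let $$\mathcal R_K=\bigcup_{J\in K}\Big(\prod_{i\in J}[-1,1]\times\prod_{i\notin J}\{-1,1\}\Big)\subseteq[-1,1]^I$$ be its real moment-angle complex, on which $\{\pm1\}^I$ acts by coordinatewise sign changes. Let $$W_K=\langle s_i\ (i\in I)\mid s_i^2=1,\ (s_is_j)^2=1\text{ whenever }\{i,j\}\in K\rangle$$ be the right-angled Coxeter group of the 1-skeleton of $K$, and let $\rho:W_K\to\{\pm1\}^I$ be the homomorphism sending $s_i$ to the sign change of the $i$-th coordinate. Let $K(K)=\mathcal R_K\cap[0,1]^I$ be the cubical chamber, with mirrors $M_i=\{x\in K(K)\mid x_i=0\}$. Whenever $(W,S)$ is a Coxeter system and $X$ is a space with closed subspaces (mirrors) $X_s$, $s\in S$, let $$U(W,X)=(W\times X)/\!\sim,\qquad (w,x)\sim(w',x)\iff w^{-1}w'\in\langle s\in S\mid x\in X_s\rangle,$$ be the basic construction, with the quotient topology ($W$ discrete) and the left multiplication action of $W$. Then: 1. The space $U(W_K,K(K))$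 is simply connected, and the map $\pi:U(W_K,K(K))\to\mathcal R_K$, $[w,x]\mapsto\rho(w)\cdot x$, is a covering map. 2. The universal cover of $\mathcal R_K$ is $W_K$-equivariantly homeomorphic to $U(W_K,K(K))$. Precisely, let $p:E\to\mathcal R_K$ be a covering map with $E$ simply connected, and let $G_p$ be the group of all pairs $(h,\varepsilon)$ of a homeomorphism $h:E\to E$ and a sign change $\varepsilon\in\{\pm1\}^I$ with $p\circ h=\varepsilon\cdot p$. Then there are a group isomorphism $\theta:W_K\to G_p$, $\theta(w)=(\theta_w,\rho(w))$, and a homeomorphism $\Phi:E\to U(W_K,K(K))$ with $\pi\circ\Phi=p$ and $\Phi(\theta_w(e))=w\cdot\Phi(e)$ for all $w\in W_K$ and $e\in E$. 3. Suppose that $K$ is flag, i.e. every nonempty finite set of vertices that are pairwise joined by edges is a simplex. Then $U(W_K,K(K))$ is the Davis complex $\Sigma(W_K,S)=U(W_K,D)$ of $W_K$ with $S=\{s_i\mid i\in I\}$. Here $D$ is the Davis chamber: the geometric realization of the poset, ordered by inclusion, of the subsets $T\subseteq I$ for which $\langle s_i\mid i\in T\rangle$ is finite, whose $i$-th mirror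 is the realization of the subposet of those $T$ that contain $i$. Precisely, there are a homeomorphism $f:K(K)\to D$ that maps each mirror of $K(K)$ onto the mirror of $D$ with the same index and a $W_K$-equivariant homeomorphism $F:U(W_K,K(K))\to\Sigma(W_K,S)$ with $F([w,x])=[w,f(x)]$ for all $w\in W_K$ and $x\in K(K)$. -/

import Mathlib

open Set Topology

universe u v

noncomputable section

/-! ### The basic construction for a Coxeter group -/

namespace CoxeterMatrix

variable {B : Type u} (M : CoxeterMatrix B) {X : Type v}

/-- For a mirror structure `(Xₛ)` on `X`, indexed by the generators of the Coxeter group `W` of `M`: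
`(w, x) ∼ (w', x')` if and only if `x = x'` and `w⁻¹w'` lies in the subgroup generated by
the generators `s` with `x ∈ Xₛ`. -/
def basicSetoid (mirror : B → Set X) : Setoid (M.Group × X) where
  r a b := a.2 = b.2 ∧ a.1⁻¹ * b.1 ∈ Subgroup.closure (M.simple '' {i | a.2 ∈ mirror i})
  iseqv :=
    { refl := fun a => ⟨rfl, by simp⟩
      symm := by
        rintro ⟨w, x⟩ ⟨w', x'⟩ ⟨h, h'⟩
        dsimp only at h h'
        subst h
        refine ⟨rfl, ?_⟩
        simpa using inv_mem h'
      trans := by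
        rintro ⟨w, x⟩ ⟨w', x'⟩ ⟨w'', x''⟩ ⟨h, h'⟩ ⟨k, k'⟩
        dsimp only at h h' k k'
        subst h
        subst k
        refine ⟨rfl, ?_⟩
        simpa [mul_assoc] using mul_mem h' k' }

/-- The basic construction `U(W, X) = (W × X)/∼`. -/
def BasicConstruction (mirror : B → Set X) : Type (max u v) :=
  Quotient (M.basicSetoid mirror)

namespace BasicConstruction

variable (mirror : B → Set X)

/-- The class `[w, x]` in `U(W, X)`. -/
def mk (w : M.Group) (x : X) : M.BasicConstruction mirror :=
  Quotient.mk (M.basicSetoid mirror) (w, x)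

/-- The quotient topology from `W × X`, where `W` is discrete. -/
instance [TopologicalSpace X] : TopologicalSpace (M.BasicConstruction mirror) :=
  letI : TopologicalSpace M.Group := ⊥
  inferInstanceAs (TopologicalSpace (Quotient (M.basicSetoid mirror)))

/-- `W` acts on `U(W, X)` by left multiplication: `w • [v, x] = [wv, x]`. -/
instance : MulAction M.Group (M.BasicConstruction mirror) where
  smul w := Quotient.map (fun a => (w * a.1, a.2)) (by
    rintro ⟨v, x⟩ ⟨v', x'⟩ ⟨h, h'⟩
    refine ⟨h, ?_⟩
    simpa [mul_assoc] using h')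
  one_smul := by
    rintro ⟨v, x⟩
    exact congrArg (fun t => mk M mirror t x) (one_mul v)
  mul_smul := by
    rintro w w' ⟨v, x⟩
    exact congrArg (fun t => mk M mirror t x) (mul_assoc w w' v)

end BasicConstruction

/-! ### The Davis complex of a Coxeter group of finite rank -/

/-- The poset, ordered by inclusion, of the spherical subsets of the generating set, i.e. of the
subsets (the empty one included) that generate a finite subgroup. -/
abbrev Spherical : Type u :=
  {T : Finset B // Finite (Subgroup.closure (M.simple '' (T : Set B)))}

end CoxeterMatrix

/-- The geometric realization of (the order complex of) a finite poset `P`: the points are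
the convex combinations of the elements of a chain, written in barycentric coordinates. -/
def posetRealization (P : Type u) [PartialOrder P] [Finite P] : Set (P → ℝ) :=
  {f | (∀ p, 0 ≤ f p) ∧ ∑ᶠ p, f p = 1 ∧ IsChain (· ≤ ·) (Function.support f)}

namespace CoxeterMatrix

variable {B : Type u} [Finite B] (M : CoxeterMatrix B)

/-- The Davis chamber: the geometric realization of the poset of spherical subsets. -/
abbrev DavisChamber : Type u := posetRealization M.Spherical

/-- The mirror of type `i` of the Davis chamber: the realization of the subposet of
the spherical subsets that contain `i`. -/
def davisMirror (i : B) : Set M.DavisChamber :=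
  {f | ∀ T : M.Spherical, f.1 T ≠ 0 → i ∈ T.1}

/-- The Davis complex `Σ(W, S)`. -/
abbrev DavisComplex : Type u := M.BasicConstruction M.davisMirror

end CoxeterMatrix

/-! ### Real moment-angle complexes -/

namespace AbstractSimplicialComplex

variable {ι : Type u} (K : AbstractSimplicialComplex ι)

open Classical in
/-- Every nonempty finite set of vertices that are pairwise joined by edges spans a simplex. -/
def IsFlag : Prop :=
  ∀ J : Finset ι, J.Nonempty →
    (∀ i ∈ J, ∀ j ∈ J, i ≠ j → {i, j} ∈ K.faces) → J ∈ K.faces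

open Classical in
/-- The Coxeter matrix of the 1-skeleton of `K`: off the diagonal, the entry is `2` at an edge, and
`0`, which stands for `∞` (no relation), at a non-edge. -/
def coxeterMatrix : CoxeterMatrix ι where
  M := fun i j => if i = j then 1 else if {i, j} ∈ K.faces then 2 else 0
  isSymm := Matrix.IsSymm.ext fun i j => by
    rw [Finset.pair_comm j i]
    by_cases h : i = j <;> simp [h, eq_comm]
  diagonal := by simp
  off_diagonal := by
    intro i j h
    simp only [h, if_false]
    split_ifs <;> decide

/-- The right-angled Coxeter group `W_K` with generators `sᵢ` and relations `sᵢ² = 1` for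
all vertices `i` and `(sᵢsⱼ)² = 1` for all edges `{i, j}`. -/
abbrev W : Type u := K.coxeterMatrix.Group

/-- The real moment-angle complex: the union, over all simplices `J` of `K` (the empty one included),
of the products of the `[-1, 1]` over `i ∈ J` and the `{±1}` over `i ∉ J`. -/
def realMomentAngle : Set (ι → ℝ) :=
  {x | ∃ J : Finset ι, (J = ∅ ∨ J ∈ K.faces) ∧
    (∀ i ∈ J, x i ∈ Icc (-1 : ℝ) 1) ∧ ∀ i ∉ J, x i = -1 ∨ x i = 1}

/-- The group `{±1}^ι` acts on the real moment-angle complex coordinatewise. -/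
instance : MulAction (ι → ℤˣ) K.realMomentAngle where
  smul ε x := ⟨fun i => ((ε i : ℤ) : ℝ) * x.1 i, by
    obtain ⟨J, hJ, h₁, h₂⟩ := x.2
    refine ⟨J, hJ, fun i hi => ?_, fun i hi => ?_⟩
    · obtain ⟨h, h'⟩ := h₁ i hi
      rcases Int.units_eq_one_or (ε i) with e | e <;> simp [e] <;> constructor <;> linarith
    · rcases Int.units_eq_one_or (ε i) with e | e <;> rcases h₂ i hi with h | h <;> simp [e, h]⟩
  one_smul x := Subtype.ext (funext fun i => by
    change (((1 : ℤˣ) : ℤ) : ℝ) * x.1 i = x.1 i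
    simp)
  mul_smul ε δ x := Subtype.ext (funext fun i => by
    change (((ε i * δ i : ℤˣ) : ℤ) : ℝ) * x.1 i = ((ε i : ℤ) : ℝ) * (((δ i : ℤ) : ℝ) * x.1 i)
    push_cast
    ring)

open Classical in
/-- The homomorphism from `W_K` to `{±1}^ι` that sends `sᵢ` to the sign change of
the `i`-th coordinate. -/
def signHom : K.W →* (ι → ℤˣ) :=
  K.coxeterMatrix.toCoxeterSystem.lift ⟨fun i => Pi.mulSingle i (-1), by
    intro i j
    by_cases h : i = j
    · subst h
      simp [coxeterMatrix, ← Pi.mulSingle_mul]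
    · by_cases h' : {i, j} ∈ K.faces
      · funext k
        rcases Int.units_eq_one_or
          ((Pi.mulSingle i (-1) * Pi.mulSingle j (-1) : ι → ℤˣ) k) with e | e <;>
            simp [coxeterMatrix, h, h', Int.units_sq]
      · simp [coxeterMatrix, h, h']⟩

/-- The cubical chamber `K(K)`, the part of the real moment-angle complex in `[0, 1]^ι`. -/
abbrev Chamber : Type u := {x : K.realMomentAngle // ∀ i, x.1 i ∈ Icc (0 : ℝ) 1}

/-- The mirror `xᵢ = 0` of the cubical chamber. -/
def mirror (i : ι) : Set K.Chamber := {x | x.1.1 i = 0}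

/-- The basic construction `U(W_K, K(K))`. -/
abbrev U : Type u := K.coxeterMatrix.BasicConstruction K.mirror

lemma signHom_smul_eq {g : K.W} {x : K.Chamber}
    (hg : g ∈ Subgroup.closure (K.coxeterMatrix.simple '' {i | x ∈ K.mirror i})) :
    K.signHom g • x.1 = x.1 := by
  classical
  have key : Subgroup.closure (K.coxeterMatrix.simple '' {i | x ∈ K.mirror i}) ≤
      (MulAction.stabilizer (ι → ℤˣ) x.1).comap K.signHom := by
    rw [Subgroup.closure_le]
    rintro _ ⟨i, hi, rfl⟩
    have hs : K.signHom (K.coxeterMatrix.simple i) = Pi.mulSingle i (-1) :=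
      (K.coxeterMatrix.toCoxeterSystem.lift_apply_simple _ i)
    change K.signHom (K.coxeterMatrix.simple i) • x.1 = x.1
    rw [hs]
    refine Subtype.ext (funext fun k => ?_)
    change ((((Pi.mulSingle i (-1) : ι → ℤˣ) k : ℤˣ) : ℤ) : ℝ) * x.1.1 k = x.1.1 k
    by_cases hk : k = i
    · subst hk
      have : x.1.1 k = 0 := hi
      simp [this]
    · simp [hk]
  exact key hg

/-- The projection of `U(W_K, K(K))` to the real moment-angle complex: `[w, x] ↦ w · x`, where `W_K` acts
through sign changes. -/
def proj : K.U → K.realMomentAngle :=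
  Quotient.lift (fun a => K.signHom a.1 • a.2.1) (by
    rintro ⟨w, x⟩ ⟨w', x'⟩ ⟨h, h'⟩
    dsimp only at h h'
    subst h
    have := K.signHom_smul_eq h'
    rw [map_mul, map_inv, mul_smul, inv_smul_eq_iff] at this
    exact this.symm)

/-- For a map `p` to the real moment-angle complex, the group of the lifts to `E` of the sign changes:
the pairs of a self-homeomorphism `h` of `E` and a sign change `ε` such that `p ∘ h = ε · p`. -/
def lifts {E : Type v} [TopologicalSpace E] (p : E → K.realMomentAngle) :
    Subgroup ((E ≃ₜ E) × (ι → ℤˣ)) where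
  carrier := {a | ∀ e, p (a.1 e) = a.2 • p e}
  one_mem' := fun e => (one_smul (ι → ℤˣ) (p e)).symm
  mul_mem' := by
    rintro ⟨h, ε⟩ ⟨k, δ⟩ ha hb e
    change p (h (k e)) = (ε * δ) • p e
    rw [mul_smul]
    exact (ha (k e)).trans (congrArg _ (hb e))
  inv_mem' := by
    rintro ⟨h, ε⟩ ha e
    change p (h.symm e) = ε⁻¹ • p e
    rw [eq_inv_smul_iff]
    exact (ha (h.symm e)).symm.trans (congrArg p (h.apply_symm_apply e))

end AbstractSimplicialComplex

end

/-! Covering. The chamber is a strict fundamental domain for the sign changes on the real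
moment-angle complex. The coordinates that vanish at a point `x` of the chamber lie in a simplex, so
the corresponding generators commute and `ρ` is injective on the subgroup `W_x` that they generate
(`Simplex.eq_one_of_signHom_eq_one`). Hence `ker ρ` acts on `U` as a group of deck transformations
whose orbits are the fibres of `π` (`isQuotientCoveringMap_proj`).

Simple connectivity. `W_K` acts on homotopy classes of paths in the complex that start at `b = (1,
..., 1)`: the generator `sᵢ` reflects a path and puts the straight path from `b` to its reflection
in front. The Coxeter relations hold because an edge `{i, j}` spans a square of the complex. A point
`[w, x]` thereby receives the class `w · (straight path from b to x)`. This is well defined, and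
along any path of `U` it changes by composition with the projected path (`pathClass_trans`, a local
statement propagated by `Path.induction_of_local`). So two paths of `U` with the same endpoints have
homotopic projections, and paths of a covering space with homotopic projections are homotopic.

Universal cover. Unique lifting identifies any simply connected cover with `U`. The point `[1, b]`
has trivial stabilizer, and the points over `ε · b` are the `[w, b]` with `ρ(w) = ε`; hence the
lifts of sign changes are exactly the elements of `W_K`.

Flag case. Two generators that do not span an edge generate an infinite dihedral group, so for flag
`K` the spherical subsets are the simplices. The two chambers are matched by `xᵢ = ∑ f(T)` over `T ∌
i`. The inverse is a layer-cake formula: `f(T)` is the length of the set of `t ∈ (0, 1]` with `{i |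
xᵢ ≤ 1 - t} = T`. -/

noncomputable section

/-! ### Homotopies inside simply connected sets and path induction -/

/-- Two paths with the same endpoints inside a simply connected set are homotopic. -/
lemma IsSimplyConnected.homotopic {X : Type*} [TopologicalSpace X] {S : Set X}
    (hS : IsSimplyConnected S) {a b : X} (p q : Path a b) (hp : ∀ t, p t ∈ S)
    (hq : ∀ t, q t ∈ S) : p.Homotopic q := by
  have := hS.simplyConnectedSpace
  have ha : a ∈ S := by simpa using hp 0
  have hb : b ∈ S := by simpa using hp 1
  let p' : Path (⟨a, ha⟩ : S) ⟨b, hb⟩ :=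
    { toFun := fun t => ⟨p t, hp t⟩, source' := by simp, target' := by simp }
  let q' : Path (⟨a, ha⟩ : S) ⟨b, hb⟩ :=
    { toFun := fun t => ⟨q t, hq t⟩, source' := by simp, target' := by simp }
  exact (SimplyConnectedSpace.paths_homotopic p' q').map ⟨Subtype.val, continuous_subtype_val⟩

/-- A subset of a subspace of a real vector space that is star-convex in the ambient space
is simply connected. -/
lemma StarConvex.isSimplyConnected_subtype {E : Type*} [AddCommGroup E] [Module ℝ E]
    [TopologicalSpace E] [ContinuousAdd E] [ContinuousSMul ℝ E] {R : Set E} {S : Set R} {a : E}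
    (h : StarConvex ℝ a (Subtype.val '' S)) (hne : S.Nonempty) : IsSimplyConnected S := by
  rw [← IsEmbedding.subtypeVal.isSimplyConnected_image]
  have := h.contractibleSpace (hne.image _)
  exact SimplyConnectedSpace.ofContractible _

/-- Path induction: a property of paths that is stable under composition holds for all paths as
soon as it holds for the paths inside the sets of an open cover. -/
lemma Path.induction_of_local {X : Type*} [TopologicalSpace X]
    (Q : ∀ a b : X, Path.Homotopic.Quotient a b → Prop)
    (htrans : ∀ a b c p q, Q a b p → Q b c q → Q a c (p.trans q))
    (hloc : ∀ x : X, ∃ V ∈ 𝓝 x, ∀ (a b : X) (p : Path a b), (∀ t, p t ∈ V) → Q a b (.mk p))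
    {a b : X} (p : Path a b) : Q a b (.mk p) := by
  choose V hV hQ using hloc
  -- Lebesgue number: the path is cut into finitely many pieces, each inside one of the given
  -- neighbourhoods.
  obtain ⟨t, ht0, hmono, ⟨N, hN⟩, hsub⟩ := exists_monotone_Icc_subset_open_cover_unitInterval
    (c := fun x : X => p ⁻¹' interior (V x)) (fun x => isOpen_interior.preimage p.continuous)
    (fun s _ => mem_iUnion.2 ⟨p s, mem_interior_iff_mem_nhds.2 (hV _)⟩)
  have step : ∀ n, Q _ _ (.mk (p.subpath (t n) (t (n + 1)))) := fun n => by
    obtain ⟨x, hx⟩ := hsub n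
    refine hQ x _ _ _ fun s => ?_
    have : p.subpath (t n) (t (n + 1)) s ∈ range (p.subpath (t n) (t (n + 1))) := ⟨s, rfl⟩
    rw [Path.range_subpath_of_le _ _ _ (hmono n.le_succ)] at this
    obtain ⟨r, hr, hr'⟩ := this
    rw [← hr']
    exact interior_subset (hx hr)
  have all : ∀ n, Q _ _ (.mk (p.subpath (t 0) (t (n + 1)))) := fun n => by
    induction n with
    | zero => exact step 0
    | succ n ih =>
      have := htrans _ _ _ _ _ ih (step (n + 1))
      rwa [← Path.Homotopic.Quotient.mk_trans,
        Path.Homotopic.Quotient.eq.2 ⟨Path.Homotopy.subpathTransSubpath p _ _ _⟩] at this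
  have h := all N
  rw [ht0, hN (N + 1) N.le_succ, Path.subpath_zero_one] at h
  -- The subpath over the whole interval runs from `p 0` to `p 1`, which agree with `a` and `b` only
  -- propositionally.
  have key : ∀ (a' b' : X) (ha : a' = a) (hb : b' = b),
      Q a' b' (.mk (p.cast ha hb)) → Q a b (.mk p) := by
    rintro _ _ rfl rfl h
    exact h
  exact key _ _ p.source p.target h

/-! ### Cubes, straight paths and open stars in the real moment-angle complex -/

namespace AbstractSimplicialComplex

variable {ι : Type u} (K : AbstractSimplicialComplex ι)

/-- `J` is a simplex of `K`, the empty simplex included. -/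
def Simplex (J : Finset ι) : Prop := J = ∅ ∨ J ∈ K.faces

variable {K}

lemma Simplex.mono {J J' : Finset ι} (h : K.Simplex J) (h' : J' ⊆ J) : K.Simplex J' := by
  rcases J'.eq_empty_or_nonempty with he | hne
  · exact .inl he
  · rcases h with rfl | h
    · exact .inl (Finset.subset_empty.1 h')
    · exact .inr ((K.isRelLowerSet_faces h).2 h' hne)

lemma simplex_singleton (i : ι) : K.Simplex {i} := .inr (K.singleton_mem i)

lemma abs_le_one (x : K.realMomentAngle) (i : ι) : x.1 i ∈ Icc (-1 : ℝ) 1 := by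
  obtain ⟨J, -, h, h'⟩ := x.2
  by_cases hi : i ∈ J
  · exact h i hi
  · rcases h' i hi with e | e <;> rw [e] <;> constructor <;> norm_num

/-- `J` is a simplex such that `a` and `b` lie in the same translate of the cube `[-1, 1]^J`. -/
def InCell (J : Finset ι) (a b : K.realMomentAngle) : Prop :=
  K.Simplex J ∧ ∀ i ∉ J, (a.1 i = -1 ∨ a.1 i = 1) ∧ b.1 i = a.1 i

lemma InCell.refl {J : Finset ι} {a b : K.realMomentAngle} (h : InCell J a b) : InCell J a a :=
  ⟨h.1, fun i hi => ⟨(h.2 i hi).1, rfl⟩⟩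

lemma InCell.symm {J : Finset ι} {a b : K.realMomentAngle} (h : InCell J a b) : InCell J b a :=
  ⟨h.1, fun i hi => ⟨by rw [(h.2 i hi).2]; exact (h.2 i hi).1, (h.2 i hi).2.symm⟩⟩

lemma InCell.trans {J : Finset ι} {a b c : K.realMomentAngle} (h : InCell J a b)
    (h' : InCell J b c) : InCell J a c :=
  ⟨h.1, fun i hi => ⟨(h.2 i hi).1, (h'.2 i hi).2.trans (h.2 i hi).2⟩⟩

lemma InCell.smul {J : Finset ι} {a b : K.realMomentAngle} (h : InCell J a b) (ε : ι → ℤˣ) :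
    InCell J (ε • a) (ε • b) := by
  refine ⟨h.1, fun i hi => ⟨?_, ?_⟩⟩
  · change ((ε i : ℤ) : ℝ) * a.1 i = -1 ∨ ((ε i : ℤ) : ℝ) * a.1 i = 1
    rcases Int.units_eq_one_or (ε i) with e | e <;> rcases (h.2 i hi).1 with h | h <;> simp [e, h]
  · change ((ε i : ℤ) : ℝ) * b.1 i = ((ε i : ℤ) : ℝ) * a.1 i
    rw [(h.2 i hi).2]

lemma lineMap_mem_Icc {a b s t r : ℝ} (ha : a ∈ Icc s t) (hb : b ∈ Icc s t)
    (hr : r ∈ Icc (0 : ℝ) 1) : AffineMap.lineMap a b r ∈ Icc s t :=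
  (convex_Icc s t).lineMap_mem ha hb hr

lemma InCell.lineMap_mem {J : Finset ι} {a b : K.realMomentAngle} (h : InCell J a b) {r : ℝ}
    (hr : r ∈ Icc (0 : ℝ) 1) : AffineMap.lineMap a.1 b.1 r ∈ K.realMomentAngle := by
  refine ⟨J, h.1, fun i _ => ?_, fun i hi => ?_⟩
  · rw [AffineMap.pi_lineMap_apply]
    exact lineMap_mem_Icc (abs_le_one a i) (abs_le_one b i) hr
  · rw [AffineMap.pi_lineMap_apply, (h.2 i hi).2, AffineMap.lineMap_same]
    exact (h.2 i hi).1

lemma InCell.lineMap {J : Finset ι} {a b : K.realMomentAngle} (h : InCell J a b) {r : ℝ}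
    (hr : r ∈ Icc (0 : ℝ) 1) : InCell J a ⟨_, h.lineMap_mem hr⟩ := by
  refine ⟨h.1, fun i hi => ⟨(h.2 i hi).1, ?_⟩⟩
  change AffineMap.lineMap a.1 b.1 r i = a.1 i
  rw [AffineMap.pi_lineMap_apply, (h.2 i hi).2, AffineMap.lineMap_same]
  rfl

/-- Two points of the real moment-angle complex are adjacent if they lie in a common cube. -/
def Adj (a b : K.realMomentAngle) : Prop := ∃ J, InCell J a b

lemma InCell.adj {J : Finset ι} {a b : K.realMomentAngle} (h : InCell J a b) : Adj a b := ⟨J, h⟩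

lemma Adj.smul {a b : K.realMomentAngle} (h : Adj a b) (ε : ι → ℤˣ) : Adj (ε • a) (ε • b) :=
  let ⟨_, hJ⟩ := h
  (hJ.smul ε).adj

/-- The straight path between two adjacent points. -/
def Adj.path {a b : K.realMomentAngle} (h : Adj a b) : Path a b where
  toFun t := ⟨AffineMap.lineMap a.1 b.1 (t : ℝ), h.choose_spec.lineMap_mem t.2⟩
  continuous_toFun := by
    refine Continuous.subtype_mk ?_ _
    exact AffineMap.lineMap_continuous.comp continuous_subtype_val
  source' := by simp
  target' := by simp

@[simp] lemma Adj.coe_path {a b : K.realMomentAngle} (h : Adj a b) (t : unitInterval) :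
    (h.path t).1 = AffineMap.lineMap a.1 b.1 (t : ℝ) := rfl

lemma isSimplyConnected_of_forall_lineMap {S : Set K.realMomentAngle} (a : K.realMomentAngle)
    (ha : a ∈ S) (h : ∀ b ∈ S, ∃ hab : Adj a b, ∀ t, hab.path t ∈ S) : IsSimplyConnected S := by
  refine StarConvex.isSimplyConnected_subtype (a := a.1) ?_ ⟨a, ha⟩
  rw [starConvex_iff_segment_subset]
  rintro _ ⟨b, hb, rfl⟩
  obtain ⟨hab, hS⟩ := h b hb
  rw [segment_eq_image_lineMap]
  rintro _ ⟨t, ht, rfl⟩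
  exact ⟨_, hS ⟨t, ht⟩, rfl⟩

lemma isSimplyConnected_cell {J : Finset ι} {a : K.realMomentAngle} (ha : InCell J a a) :
    IsSimplyConnected {b | InCell J a b} :=
  isSimplyConnected_of_forall_lineMap a ha fun _ hb => ⟨hb.adj, fun t => hb.lineMap t.2⟩

/-- The homotopy class of the straight path between two adjacent points. -/
def Adj.str {a b : K.realMomentAngle} (h : Adj a b) : Path.Homotopic.Quotient a b := .mk h.path

lemma InCell.mk_eq_str {J : Finset ι} {a b : K.realMomentAngle} (h : InCell J a b)
    (p : Path a b) (hp : ∀ t, InCell J a (p t)) : .mk p = h.adj.str :=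
  Path.Homotopic.Quotient.eq.2 <| (isSimplyConnected_cell h.refl).homotopic _ _ hp
    fun t => h.lineMap t.2

/-- A triangle inside one cube can be filled, as cubes are convex. All homotopies behind the Coxeter
relations come from here. -/
lemma InCell.str_trans {J : Finset ι} {a b c : K.realMomentAngle} (h : InCell J a b)
    (h' : InCell J a c) (hab : Adj a b) (hbc : Adj b c) (hac : Adj a c) :
    hab.str.trans hbc.str = hac.str := by
  refine InCell.mk_eq_str h' (hab.path.trans hbc.path) fun t => ?_
  have : hab.path.trans hbc.path t ∈ range (hab.path.trans hbc.path) := ⟨t, rfl⟩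
  rw [Path.trans_range] at this
  rcases this with ⟨s, hs⟩ | ⟨s, hs⟩ <;> rw [← hs]
  · exact h.lineMap s.2
  · exact h.trans ((h.symm.trans h').lineMap s.2)

lemma Adj.str_self {a : K.realMomentAngle} (h : Adj a a) : h.str = .refl a := by
  refine congrArg Path.Homotopic.Quotient.mk (Path.ext (funext fun t => Subtype.ext ?_))
  simp

lemma Adj.heq_str {a b b' : K.realMomentAngle} (h : Adj a b) (h' : Adj a b') (e : b = b') :
    HEq h.str h'.str := by
  subst e
  rfl

instance : ContinuousConstSMul (ι → ℤˣ) K.realMomentAngle where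
  continuous_const_smul ε := by
    refine Continuous.subtype_mk (continuous_pi fun i => ?_) _
    exact continuous_const.mul ((continuous_apply i).comp continuous_subtype_val)

lemma smul_apply (ε : ι → ℤˣ) (x : K.realMomentAngle) (i : ι) :
    (ε • x).1 i = ((ε i : ℤ) : ℝ) * x.1 i := rfl

variable (K) in
/-- The action of a sign change as a continuous map. -/
def smulMap (ε : ι → ℤˣ) : C(K.realMomentAngle, K.realMomentAngle) :=
  ⟨fun x => ε • x, continuous_const_smul ε⟩

lemma Adj.map_str {a b : K.realMomentAngle} (h : Adj a b) (ε : ι → ℤˣ) :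
    h.str.map (K.smulMap ε) = (h.smul ε).str := by
  refine congrArg Path.Homotopic.Quotient.mk
    (Path.ext (funext fun t => Subtype.ext (funext fun i => ?_)))
  change ((ε i : ℤ) : ℝ) * AffineMap.lineMap a.1 b.1 (t : ℝ) i =
    AffineMap.lineMap (ε • a).1 (ε • b).1 (t : ℝ) i
  simp only [AffineMap.pi_lineMap_apply, AffineMap.lineMap_apply, smul_apply]
  simp
  ring

/-- The open star of a point of the real moment-angle complex. -/
def star (a : K.realMomentAngle) : Set K.realMomentAngle :=
  {b | ∀ i, (a.1 i = 1 → 0 < b.1 i) ∧ (a.1 i = -1 → b.1 i < 0) ∧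
    (a.1 i ∈ Ioo (-1 : ℝ) 1 → b.1 i ∈ Ioo (-1 : ℝ) 1)}

lemma self_mem_star (a : K.realMomentAngle) : a ∈ star a := fun i =>
  ⟨fun h => by rw [h]; norm_num, fun h => by rw [h]; norm_num, id⟩

lemma isOpen_star [Finite ι] (a : K.realMomentAngle) : IsOpen (star a) := by
  have hc : ∀ i, Continuous fun b : K.realMomentAngle => b.1 i := fun i =>
    (continuous_apply i).comp continuous_subtype_val
  have : star a = ⋂ i, ({b | a.1 i = 1 → 0 < b.1 i} ∩ ({b | a.1 i = -1 → b.1 i < 0} ∩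
      {b | a.1 i ∈ Ioo (-1 : ℝ) 1 → b.1 i ∈ Ioo (-1 : ℝ) 1})) := by
    ext b
    simp [star]
  rw [this]
  refine isOpen_iInter_of_finite fun i => ?_
  refine IsOpen.inter ?_ (IsOpen.inter ?_ ?_)
  · by_cases h : a.1 i = 1
    · simpa [h] using isOpen_lt continuous_const (hc i)
    · simp [h]
  · by_cases h : a.1 i = -1
    · simpa [h] using isOpen_lt (hc i) continuous_const
    · simp [h]
  · by_cases h : a.1 i ∈ Ioo (-1 : ℝ) 1
    · simp only [h, true_imp_iff]
      exact isOpen_Ioo.preimage (hc i)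
    · simp [h]

/-- Outside the simplex of a cube that contains `b`, the coordinates of `b` are `±1`; the star
conditions then force `a` to have the same ones. -/
lemma exists_inCell_of_mem_star {a b : K.realMomentAngle} (h : b ∈ star a) :
    ∃ J, InCell J a b := by
  obtain ⟨J, hJ, -, h'⟩ := b.2
  refine ⟨J, hJ, fun i hi => ?_⟩
  obtain ⟨h1, h2, h3⟩ := h i
  have ha := abs_le_one a i
  rcases eq_or_lt_of_le ha.1 with e | e
  · have := h2 e.symm
    refine ⟨.inl e.symm, ?_⟩
    rcases h' i hi with e' | e' <;> linarith
  rcases eq_or_lt_of_le ha.2 with e' | e'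
  · have := h1 e'
    refine ⟨.inr e', ?_⟩
    rcases h' i hi with e'' | e'' <;> linarith
  · have := h3 ⟨e, e'⟩
    rcases h' i hi with e'' | e'' <;> simp [e''] at this

lemma adj_of_mem_star {a b : K.realMomentAngle} (h : b ∈ star a) : Adj a b :=
  exists_inCell_of_mem_star h

lemma Adj.path_mem_star {a b : K.realMomentAngle} (hab : Adj a b) (h : b ∈ star a)
    (t : unitInterval) : hab.path t ∈ star a := by
  intro i
  obtain ⟨h1, h2, h3⟩ := h i
  rw [Adj.coe_path, AffineMap.pi_lineMap_apply]
  refine ⟨fun e => ?_, fun e => ?_, fun e => ?_⟩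
  · exact (convex_Ioi (0 : ℝ)).lineMap_mem (by rw [e]; exact one_pos (α := ℝ)) (h1 e) t.2
  · exact (convex_Iio (0 : ℝ)).lineMap_mem (by rw [e]; simp) (h2 e) t.2
  · exact (convex_Ioo (-1 : ℝ) 1).lineMap_mem e (h3 e) t.2

lemma isSimplyConnected_star (a : K.realMomentAngle) : IsSimplyConnected (star a) :=
  isSimplyConnected_of_forall_lineMap a (self_mem_star a) fun _ hb =>
    ⟨adj_of_mem_star hb, Adj.path_mem_star _ hb⟩

/-- The star is star-shaped about `a`, hence simply connected, although `b` and `c` need not lie in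
a common cube. -/
lemma str_trans_of_mem_star {a b c : K.realMomentAngle} (hab : Adj a b) (hac : Adj a c)
    (p : Path b c) (hp : ∀ t, p t ∈ star a) : hab.str.trans (.mk p) = hac.str := by
  have hb : b ∈ star a := by simpa using hp 0
  have hc : c ∈ star a := by simpa using hp 1
  refine Path.Homotopic.Quotient.eq.2 <| (isSimplyConnected_star a).homotopic
    (hab.path.trans p) _ (fun t => ?_) (hac.path_mem_star hc)
  have : hab.path.trans p t ∈ range (hab.path.trans p) := ⟨t, rfl⟩
  rw [Path.trans_range] at this
  rcases this with ⟨s, hs⟩ | ⟨s, hs⟩ <;> rw [← hs]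
  · exact hab.path_mem_star hb s
  · exact hp s

instance [Finite ι] : LocallyPathConnectedSpace K.realMomentAngle := by
  have := Fintype.ofFinite ι
  refine LocallyPathConnectedSpace.of_bases
    (p := fun _ r => (0 : ℝ) < r) (s := fun a r => star a ∩ Metric.ball a r) (fun a => ?_) ?_
  · refine ⟨fun t => ⟨fun ht => ?_, fun ⟨r, hr, hrt⟩ => Filter.mem_of_superset (Filter.inter_mem
      ((isOpen_star a).mem_nhds (self_mem_star a)) (Metric.ball_mem_nhds a hr)) hrt⟩⟩
    obtain ⟨r, hr, hrt⟩ := Metric.mem_nhds_iff.1 ht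
    exact ⟨r, hr, inter_subset_right.trans hrt⟩
  · intro a r hr
    refine IsSimplyConnected.isPathConnected <| isSimplyConnected_of_forall_lineMap a
      ⟨self_mem_star a, Metric.mem_ball_self hr⟩ fun b hb => ⟨adj_of_mem_star hb.1, fun t =>
        ⟨Adj.path_mem_star _ hb.1 t, ?_⟩⟩
    exact (convex_ball a.1 r).lineMap_mem (Metric.mem_ball_self hr) hb.2 t.2

end AbstractSimplicialComplex

/-! ### Special subgroups and sign changes -/

namespace CoxeterMatrix

variable {B : Type u} (M : CoxeterMatrix B)

lemma simple_mul_self (i : B) : M.simple i * M.simple i = 1 :=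
  M.toCoxeterSystem.simple_mul_simple_self i

lemma commute_simple {i j : B} (h : M i j = 2) : Commute (M.simple i) (M.simple j) := by
  have h2 : (M.simple i * M.simple j) ^ M i j = 1 := M.toCoxeterSystem.simple_mul_simple_pow i j
  rw [h, pow_two] at h2
  have h3 := eq_inv_of_mul_eq_one_left h2
  rwa [mul_inv_rev, inv_eq_of_mul_eq_one_left (M.simple_mul_self i),
    inv_eq_of_mul_eq_one_left (M.simple_mul_self j)] at h3

/-- The homomorphism from the group of order two that sends the generator to `sᵢ`. -/
def signToSimple (i : B) : ℤˣ →* M.Group where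
  toFun ε := if ε = 1 then 1 else M.simple i
  map_one' := by simp
  map_mul' ε δ := by
    rcases Int.units_eq_one_or ε with rfl | rfl <;> rcases Int.units_eq_one_or δ with rfl | rfl <;>
      simp [simple_mul_self, show (-1 : ℤˣ) ≠ 1 by decide]

end CoxeterMatrix

namespace AbstractSimplicialComplex

variable {ι : Type u} {K : AbstractSimplicialComplex ι}

open Classical in
lemma signHom_simple (i : ι) :
    K.signHom (K.coxeterMatrix.simple i) = Pi.mulSingle i (-1) :=
  K.coxeterMatrix.toCoxeterSystem.lift_apply_simple _ i

open Classical in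
lemma commute_simple {i j : ι} (h : i ≠ j) (h' : {i, j} ∈ K.faces) :
    Commute (K.coxeterMatrix.simple i) (K.coxeterMatrix.simple j) :=
  K.coxeterMatrix.commute_simple <| by
    change (if i = j then 1 else if {i, j} ∈ K.faces then 2 else 0) = 2
    rw [if_neg h, if_pos h']

lemma Simplex.commute_simple {J : Finset ι} (hJ : K.Simplex J) {i j : ι} (hi : i ∈ J)
    (hj : j ∈ J) : Commute (K.coxeterMatrix.simple i) (K.coxeterMatrix.simple j) := by
  classical
  by_cases h : i = j
  · rw [h]
  · refine AbstractSimplicialComplex.commute_simple h ?_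
    have hsub : ({i, j} : Finset ι) ⊆ J := by
      intro k hk
      rcases Finset.mem_insert.1 hk with rfl | hk
      · exact hi
      · rwa [Finset.mem_singleton.1 hk]
    rcases hJ.mono hsub with h | h
    · simp at h
    · convert h

variable [Finite ι]

/-- `ρ` is injective on the special subgroup of a simplex. -/
lemma Simplex.eq_one_of_signHom_eq_one {J : Finset ι} (hJ : K.Simplex J) {T : Set ι}
    (hT : T ⊆ J) {g : K.W} (hg : g ∈ Subgroup.closure (K.coxeterMatrix.simple '' T))
    (h : K.signHom g = 1) : g = 1 := by
  classical
  have := Fintype.ofFinite ι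
  -- The generators of `J` commute, so these maps assemble to a homomorphism `{±1}^ι → W_K`. It is a
  -- left inverse of `ρ` on the subgroup generated by `T ⊆ J`.
  let φ : ∀ i : ι, ℤˣ →* K.W := fun i => if i ∈ J then K.coxeterMatrix.signToSimple i else 1
  have hφ : Pairwise fun i j => ∀ x y, Commute (φ i x) (φ j y) := by
    intro i j _ x y
    by_cases hi : i ∈ J
    swap
    · simp [φ, hi]
    by_cases hj : j ∈ J
    swap
    · simp [φ, hj]
    rcases Int.units_eq_one_or x with rfl | rfl
    · simp
    rcases Int.units_eq_one_or y with rfl | rfl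
    · simp
    simpa [φ, hi, hj, CoxeterMatrix.signToSimple] using hJ.commute_simple hi hj
  let σ := MonoidHom.noncommPiCoprod φ hφ
  have key : EqOn (σ.comp K.signHom) (MonoidHom.id _) (K.coxeterMatrix.simple '' T) := by
    rintro _ ⟨i, hi, rfl⟩
    have hi' : i ∈ J := hT hi
    change σ (K.signHom (K.coxeterMatrix.simple i)) = K.coxeterMatrix.simple i
    rw [signHom_simple, MonoidHom.noncommPiCoprod_mulSingle]
    simp [φ, hi', CoxeterMatrix.signToSimple]
  have := MonoidHom.eqOn_closure key hg
  change σ (K.signHom g) = g at this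
  rw [← this, h, map_one]

/-- Sign changes supported in `T` come from the special subgroup of `T`. -/
lemma exists_signHom_eq (T : Set ι) (ε : ι → ℤˣ) (h : ∀ i ∉ T, ε i = 1) :
    ∃ g ∈ Subgroup.closure (K.coxeterMatrix.simple '' T), K.signHom g = ε := by
  classical
  have := Fintype.ofFinite ι
  change ε ∈ (Subgroup.closure (K.coxeterMatrix.simple '' T)).map K.signHom
  rw [← Finset.univ_prod_mulSingle ε]
  refine Subgroup.prod_mem _ fun i _ => ?_
  rcases Int.units_eq_one_or (ε i) with e | e
  · rw [e, Pi.mulSingle_one]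
    exact one_mem _
  · have hi : i ∈ T := by
      by_contra hi
      rw [h i hi] at e
      exact absurd e (by decide)
    rw [e]
    refine ⟨_, Subgroup.subset_closure (mem_image_of_mem _ hi), ?_⟩
    rw [signHom_simple]

lemma signHom_surjective : Function.Surjective K.signHom := fun ε =>
  let ⟨g, _, hg⟩ := exists_signHom_eq univ ε (fun i hi => absurd (mem_univ i) hi)
  ⟨g, hg⟩

end AbstractSimplicialComplex

/-! ### Topology of the basic construction -/

namespace CoxeterMatrix.BasicConstruction

variable {B : Type u} {M : CoxeterMatrix B} {X : Type v} {mirror : B → Set X}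

lemma mk_eq_mk {w w' : M.Group} {x x' : X} : mk M mirror w x = mk M mirror w' x' ↔
    x = x' ∧ w⁻¹ * w' ∈ Subgroup.closure (M.simple '' {i | x ∈ mirror i}) :=
  Quotient.eq (r := M.basicSetoid mirror)

@[elab_as_elim]
lemma ind {p : M.BasicConstruction mirror → Prop} (h : ∀ w x, p (mk M mirror w x)) (u) : p u :=
  Quotient.ind (fun a => h a.1 a.2) u

@[simp] lemma smul_mk (w w' : M.Group) (x : X) :
    w • mk M mirror w' x = mk M mirror (w * w') x := rfl

variable [TopologicalSpace X]

lemma continuous_iff {Y : Type*} [TopologicalSpace Y] {f : M.BasicConstruction mirror → Y} :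
    Continuous f ↔ ∀ w, Continuous fun x => f (mk M mirror w x) := by
  let : TopologicalSpace M.Group := ⊥
  have : DiscreteTopology M.Group := ⟨rfl⟩
  have hq : IsQuotientMap (Quotient.mk (M.basicSetoid mirror)) := isQuotientMap_quotient_mk'
  exact hq.continuous_iff.trans continuous_prod_of_discrete_left

lemma continuous_mk (w : M.Group) : Continuous (mk M mirror w) :=
  continuous_iff.1 continuous_id w

lemma isOpen_iff {V : Set (M.BasicConstruction mirror)} :
    IsOpen V ↔ ∀ w, IsOpen {x | mk M mirror w x ∈ V} := by
  simp only [isOpen_iff_continuous_mem]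
  exact continuous_iff

instance : ContinuousConstSMul M.Group (M.BasicConstruction mirror) where
  continuous_const_smul w := continuous_iff.2 fun w' => continuous_mk (w * w')

end CoxeterMatrix.BasicConstruction

/-! ### The projection is a covering map -/

open CoxeterMatrix.BasicConstruction

local notation "pt" => CoxeterMatrix.BasicConstruction.mk _ (AbstractSimplicialComplex.mirror _)

namespace AbstractSimplicialComplex

variable {ι : Type u} {K : AbstractSimplicialComplex ι}

lemma simplex_of_zeros (x : K.realMomentAngle) :
    ∃ J, K.Simplex J ∧ {i | x.1 i = 0} ⊆ J := by
  obtain ⟨J, hJ, -, h⟩ := x.2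
  refine ⟨J, hJ, fun i (hi : x.1 i = 0) => ?_⟩
  by_contra hiJ
  rcases h i hiJ with e | e <;> rw [hi] at e <;> norm_num at e

lemma proj_mk (w : K.W) (x : K.Chamber) :
    K.proj (pt w x) = K.signHom w • x.1 := rfl

lemma proj_smul (w : K.W) (u : K.U) : K.proj (w • u) = K.signHom w • K.proj u := by
  induction u using CoxeterMatrix.BasicConstruction.ind with | h w' x =>
  rw [smul_mk, proj_mk, proj_mk, map_mul, mul_smul]

lemma continuous_proj : Continuous K.proj :=
  continuous_iff.2 fun _ => (continuous_const_smul (K.signHom _)).comp continuous_subtype_val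

lemma exists_smul_chamber (y : K.realMomentAngle) :
    ∃ (ε : ι → ℤˣ) (x : K.Chamber), ε • x.1 = y := by
  classical
  let ε : ι → ℤˣ := fun i => if y.1 i < 0 then -1 else 1
  have hε : ∀ i, (ε⁻¹ • y).1 i ∈ Icc (0 : ℝ) 1 := by
    intro i
    have := abs_le_one y i
    rw [smul_apply]
    by_cases h : y.1 i < 0
    · simp only [ε, h, Pi.inv_apply, if_true]
      constructor <;> simp <;> linarith [this.1]
    · simp only [ε, h, Pi.inv_apply, if_false]
      constructor <;> simp <;> linarith [this.2]
  exact ⟨ε, ⟨ε⁻¹ • y, hε⟩, smul_inv_smul ε y⟩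

/-- The chamber is a strict fundamental domain: nonnegative coordinates are determined up to sign,
and a sign is ambiguous only where the coordinate is zero. -/
lemma eq_of_smul_eq {ε : ι → ℤˣ} {x y : K.Chamber} (h : ε • x.1 = y.1) :
    x = y ∧ ∀ i, x.1.1 i ≠ 0 → ε i = 1 := by
  have hi : ∀ i, ((ε i : ℤ) : ℝ) * x.1.1 i = y.1.1 i := fun i => by rw [← smul_apply, h]
  have key : ∀ i, x.1.1 i = y.1.1 i ∧ (x.1.1 i ≠ 0 → ε i = 1) := fun i => by
    have hx := (x.2 i).1
    have hy := (y.2 i).1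
    have := hi i
    rcases Int.units_eq_one_or (ε i) with e | e
    · simpa [e] using this
    · simp only [e, Units.val_neg, Units.val_one, Int.cast_neg, Int.cast_one, neg_mul,
        one_mul] at this
      exact ⟨by linarith, fun h => absurd (by linarith) h⟩
  exact ⟨Subtype.ext (Subtype.ext (funext fun i => (key i).1)), fun i => (key i).2⟩

lemma isClosed_chamber : IsClosed {x : K.realMomentAngle | ∀ i, x.1 i ∈ Icc (0 : ℝ) 1} := by
  simp only [ofPred_forall]
  exact isClosed_iInter fun i =>
    isClosed_Icc.preimage ((continuous_apply i).comp continuous_subtype_val)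

variable (K) in
/-- The point of the chamber all of whose coordinates are `1`. -/
def basePoint : K.Chamber :=
  ⟨⟨fun _ => 1, ∅, .inl rfl, by simp, by simp⟩, fun _ => by simp⟩

/-- The neighbourhood of `[w, x]` that consists of the points `[wv, y]` where `v` fixes `x` and `y`
lies on no other mirrors than `x`. -/
def nhd (w : K.W) (x : K.Chamber) : Set K.U :=
  {u | ∃ v ∈ Subgroup.closure (K.coxeterMatrix.simple '' {i | x ∈ K.mirror i}), ∃ y : K.Chamber,
    (∀ i, y ∈ K.mirror i → x ∈ K.mirror i) ∧ u = pt (w * v) y}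

lemma mk_mem_nhd (w : K.W) (x : K.Chamber) : pt w x ∈ nhd w x :=
  ⟨1, one_mem _, x, fun _ => id, by rw [mul_one]⟩

/-- Membership does not depend on the representative `w'`: since `y` lies on no other mirrors than
`x`, its mirror subgroup is contained in that of `x`. -/
lemma mk_mem_nhd_iff {w w' : K.W} {x y : K.Chamber} : pt w' y ∈ nhd w x ↔
    w⁻¹ * w' ∈ Subgroup.closure (K.coxeterMatrix.simple '' {i | x ∈ K.mirror i}) ∧
      ∀ i, y ∈ K.mirror i → x ∈ K.mirror i := by
  constructor
  · rintro ⟨v, hv, y', hy', h⟩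
    obtain ⟨rfl, hv'⟩ := mk_eq_mk.1 h
    refine ⟨?_, hy'⟩
    have h2 := Subgroup.closure_mono (image_mono (f := K.coxeterMatrix.simple)
      (show {i | y ∈ K.mirror i} ⊆ {i | x ∈ K.mirror i} from hy')) hv'
    have := mul_mem hv (inv_mem h2)
    simpa [mul_assoc] using this
  · rintro ⟨h, hy⟩
    exact ⟨_, h, y, hy, by rw [mul_inv_cancel_left]⟩

variable [Finite ι]

lemma isOpen_nhd (w : K.W) (x : K.Chamber) : IsOpen (nhd w x) := by
  rw [isOpen_iff]
  intro w'
  simp only [mk_mem_nhd_iff]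
  refine isOpen_const.inter ?_
  change IsOpen {y : K.Chamber | ∀ i, y ∈ K.mirror i → x ∈ K.mirror i}
  simp only [ofPred_forall]
  refine isOpen_iInter_of_finite fun i => ?_
  by_cases h : x ∈ K.mirror i
  · simp [h]
  · simp only [h, imp_false]
    refine (isClosed_singleton (x := (0 : ℝ))).isOpen_compl.preimage ?_
    exact (continuous_apply i).comp (continuous_subtype_val.comp continuous_subtype_val)

lemma surjective_proj : Function.Surjective K.proj := fun y => by
  obtain ⟨ε, x, rfl⟩ := exists_smul_chamber y
  obtain ⟨w, rfl⟩ := signHom_surjective (K := K) ε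
  exact ⟨pt w x, rfl⟩

/-- The complex is a finite union of closed translates of the chamber, and closedness can be tested
on each of them. -/
lemma isQuotientMap_proj : IsQuotientMap K.proj := by
  refine isQuotientMap_iff_isClosed.2 ⟨surjective_proj, fun s =>
    ⟨fun h => h.preimage continuous_proj, fun h => ?_⟩⟩
  have hs : s = ⋃ ε : ι → ℤˣ, (fun x : K.Chamber => ε • x.1) '' {x | ε • x.1 ∈ s} := by
    ext y
    simp only [mem_iUnion]
    constructor
    · intro hy
      obtain ⟨ε, x, rfl⟩ := exists_smul_chamber y
      exact ⟨ε, x, hy, rfl⟩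
    · rintro ⟨ε, x, hx, rfl⟩
      exact hx
  rw [hs]
  refine isClosed_iUnion_of_finite fun ε => ?_
  refine ((Homeomorph.smul ε).isClosedEmbedding.comp
    isClosed_chamber.isClosedEmbedding_subtypeVal).isClosedMap _ ?_
  obtain ⟨w, rfl⟩ := signHom_surjective (K := K) ε
  exact h.preimage (continuous_mk w)

lemma isQuotientCoveringMap_proj : IsQuotientCoveringMap K.proj K.signHom.ker where
  toIsQuotientMap := isQuotientMap_proj
  continuous_const_smul g := continuous_const_smul (g : K.W)
  apply_eq_iff_mem_orbit {u u'} := by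
    constructor
    · induction u using CoxeterMatrix.BasicConstruction.ind with | h w x =>
      induction u' using CoxeterMatrix.BasicConstruction.ind with | h w' x' =>
      intro h
      rw [proj_mk, proj_mk, ← eq_inv_smul_iff, ← mul_smul, eq_comm] at h
      obtain ⟨rfl, hε⟩ := eq_of_smul_eq h
      obtain ⟨g, hg, hg'⟩ := exists_signHom_eq (K := K) {i | x' ∈ K.mirror i} _ hε
      refine ⟨⟨w * g * w'⁻¹, ?_⟩, ?_⟩
      · rw [MonoidHom.mem_ker, map_mul, map_mul, hg', map_inv]
        group
      · change pt (w * g * w'⁻¹ * w') x' = pt w x'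
        refine mk_eq_mk.2 ⟨rfl, ?_⟩
        have := inv_mem hg
        simpa [mul_assoc] using this
    · rintro ⟨g, rfl⟩
      change K.proj ((g : K.W) • u') = _
      rw [proj_smul, g.2, one_smul]
  disjoint u := by
    induction u using CoxeterMatrix.BasicConstruction.ind with | h w x =>
    refine ⟨nhd w x, (isOpen_nhd w x).mem_nhds (mk_mem_nhd w x), ?_⟩
    rintro ⟨g, hg⟩ ⟨_, ⟨u, hu, rfl⟩, hu'⟩
    revert hu hu'
    induction u using CoxeterMatrix.BasicConstruction.ind with | h w' y =>
    intro hu hu'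
    change pt (g * w') y ∈ nhd w x at hu'
    rw [mk_mem_nhd_iff] at hu hu'
    -- If `[w', y]` and its translate by `g` both lie in the neighbourhood, then `w⁻¹gw` lies in the
    -- mirror subgroup of `x`. It is killed by `ρ`, hence trivial.
    have h := mul_mem hu'.1 (inv_mem hu.1)
    obtain ⟨J, hJ, hxJ⟩ := simplex_of_zeros x.1
    have h1 := hJ.eq_one_of_signHom_eq_one hxJ h (by
      rw [MonoidHom.mem_ker] at hg
      simp [hg])
    refine Subtype.ext ?_
    have h2 : w⁻¹ * g * w = 1 := by rw [← h1]; group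
    change g = 1
    calc g = w * (w⁻¹ * g * w) * w⁻¹ := by group
      _ = 1 := by rw [h2]; group

theorem isCoveringMap_proj : IsCoveringMap K.proj := isQuotientCoveringMap_proj.isCoveringMap

end AbstractSimplicialComplex

/-! ### Simple connectivity through the action on based paths -/

namespace Path.Homotopic.Quotient

variable {X Y : Type*} [TopologicalSpace X] [TopologicalSpace Y]

lemma map_trans {a b c : X} (p : Path.Homotopic.Quotient a b) (q : Path.Homotopic.Quotient b c)
    (f : C(X, Y)) : (p.trans q).map f = (p.map f).trans (q.map f) := by
  induction p with | mk p =>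
  induction q with | mk q =>
  exact congrArg Path.Homotopic.Quotient.mk (Path.map_trans p q f.continuous)

lemma trans_left_cancel {a b c : X} {p : Path.Homotopic.Quotient a b}
    {q q' : Path.Homotopic.Quotient b c} (h : p.trans q = p.trans q') : q = q' := by
  rw [← refl_trans q, ← refl_trans q', ← symm_trans p, trans_assoc, trans_assoc, h]

/-- Endpoints such as `ε • δ • y` and `(ε * δ) • y` agree only propositionally, so classes are
compared in the sigma type and their factors up to `HEq`. -/
lemma sigma_trans_congr {a b b' c c' : X} (hb : b = b') (hc : c = c')
    {p : Path.Homotopic.Quotient a b} {p' : Path.Homotopic.Quotient a b'}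
    {q : Path.Homotopic.Quotient b c} {q' : Path.Homotopic.Quotient b' c'}
    (hp : HEq p p') (hq : HEq q q') :
    (⟨c, p.trans q⟩ : Σ y, Path.Homotopic.Quotient a y) = ⟨c', p'.trans q'⟩ := by
  subst hb
  subst hc
  rw [eq_of_heq hp, eq_of_heq hq]

end Path.Homotopic.Quotient

namespace AbstractSimplicialComplex

open Path.Homotopic (Quotient)

variable {ι : Type u} {K : AbstractSimplicialComplex ι}

/-- Chamber coordinates are nonnegative, so those equal to `±1` are `1`, as for the base point. -/
lemma InCell.basePoint {J : Finset ι} {x : K.Chamber} {y : K.realMomentAngle}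
    (h : InCell J x.1 y) : InCell J K.basePoint.1 x.1 := by
  refine ⟨h.1, fun i hi => ⟨.inr rfl, ?_⟩⟩
  rcases (h.2 i hi).1 with e | e
  · have := (x.2 i).1
    rw [e] at this
    norm_num at this
  · exact e

lemma exists_inCell_basePoint (x : K.Chamber) : ∃ J, InCell J K.basePoint.1 x.1 := by
  obtain ⟨J, hJ, -, h⟩ := x.1.2
  exact ⟨J, InCell.basePoint (y := x.1) ⟨hJ, fun i hi => ⟨h i hi, rfl⟩⟩⟩

lemma inCell_basePoint_smul {J : Finset ι} (hJ : K.Simplex J) {ε : ι → ℤˣ}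
    (h : ∀ i ∉ J, ε i = 1) : InCell J K.basePoint.1 (ε • K.basePoint.1) :=
  ⟨hJ, fun i hi => ⟨.inr rfl, by rw [smul_apply, h i hi]; simp⟩⟩

variable (K) in
/-- The homotopy classes of the paths in the real moment-angle complex that start at the
base point. -/
abbrev BasedPath : Type u := Σ y : K.realMomentAngle, Quotient K.basePoint.1 y

/-- The action of sign changes on homotopy classes of paths. -/
def signMap (ε : ι → ℤˣ) {a b : K.realMomentAngle} (γ : Quotient a b) : Quotient (ε • a) (ε • b) :=
  γ.map (K.smulMap ε)

lemma signMap_trans (ε : ι → ℤˣ) {a b c : K.realMomentAngle} (γ : Quotient a b)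
    (γ' : Quotient b c) : signMap ε (γ.trans γ') = (signMap ε γ).trans (signMap ε γ') :=
  Path.Homotopic.Quotient.map_trans γ γ' _

lemma signMap_str (ε : ι → ℤˣ) {a b : K.realMomentAngle} (h : Adj a b) :
    signMap ε h.str = (h.smul ε).str := h.map_str ε

lemma heq_signMap_mul (ε δ : ι → ℤˣ) {a b : K.realMomentAngle} (γ : Quotient a b) :
    HEq (signMap ε (signMap δ γ)) (signMap (ε * δ) γ) := by
  induction γ with | mk γ =>
  exact Path.Homotopic.hpath_hext fun t => (mul_smul ε δ (γ t)).symm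

lemma heq_signMap_one {a b : K.realMomentAngle} (γ : Quotient a b) : HEq (signMap 1 γ) γ := by
  induction γ with | mk γ =>
  exact Path.Homotopic.hpath_hext fun t => one_smul (ι → ℤˣ) (γ t)

/-- The lift of a sign change to the classes of based paths. -/
def liftSign {ε : ι → ℤˣ} (h : Adj K.basePoint.1 (ε • K.basePoint.1)) : Function.End K.BasedPath :=
  fun p => ⟨ε • p.1, h.str.trans (signMap ε p.2)⟩

/-- The straight paths from `b` to `εb` and on to `εδb` stay in the single cube `[-1, 1]^J × {1}`,
so they compose to the straight path. -/
lemma liftSign_mul {J : Finset ι} {ε δ : ι → ℤˣ}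
    (hε : InCell J K.basePoint.1 (ε • K.basePoint.1))
    (hδ : InCell J K.basePoint.1 (δ • K.basePoint.1))
    (h : Adj K.basePoint.1 ((ε * δ) • K.basePoint.1)) :
    liftSign hε.adj * liftSign hδ.adj = liftSign h := by
  funext ⟨y, γ⟩
  have h1 := hδ.smul ε
  have h2 : hε.adj.str.trans h1.adj.str = (hε.trans h1).adj.str :=
    hε.str_trans (hε.trans h1) _ _ _
  change (⟨ε • δ • y, hε.adj.str.trans (signMap ε (hδ.adj.str.trans (signMap δ γ)))⟩ :
    K.BasedPath) = ⟨(ε * δ) • y, h.str.trans (signMap (ε * δ) γ)⟩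
  rw [signMap_trans, signMap_str, ← Path.Homotopic.Quotient.trans_assoc]
  exact Path.Homotopic.Quotient.sigma_trans_congr (mul_smul _ _ _).symm (mul_smul _ _ _).symm
    ((heq_of_eq h2).trans (Adj.heq_str _ _ (mul_smul _ _ _).symm)) (heq_signMap_mul ε δ γ)

lemma liftSign_one (h : Adj K.basePoint.1 ((1 : ι → ℤˣ) • K.basePoint.1)) :
    liftSign h = 1 := by
  funext ⟨y, γ⟩
  have h0 : Adj K.basePoint.1 K.basePoint.1 := by simpa using h
  have h1 : (⟨y, γ⟩ : K.BasedPath) = ⟨y, h0.str.trans γ⟩ := by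
    rw [Adj.str_self, Path.Homotopic.Quotient.refl_trans]
  refine Eq.trans ?_ h1.symm
  exact Path.Homotopic.Quotient.sigma_trans_congr (one_smul _ _) (one_smul _ _)
    (Adj.heq_str _ _ (one_smul _ _)) (heq_signMap_one γ)

lemma liftSign_congr {ε δ : ι → ℤˣ} (h : Adj K.basePoint.1 (ε • K.basePoint.1))
    (e : ε = δ) (h' : Adj K.basePoint.1 (δ • K.basePoint.1)) : liftSign h = liftSign h' := by
  subst e
  rfl

open Classical in
lemma inCell_mulSingle {J : Finset ι} (hJ : K.Simplex J) {i : ι} (hi : i ∈ J) :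
    InCell J K.basePoint.1 ((Pi.mulSingle i (-1) : ι → ℤˣ) • K.basePoint.1) :=
  inCell_basePoint_smul hJ fun j hj => Pi.mulSingle_eq_of_ne (by rintro rfl; exact hj hi) _

open Classical in
lemma adj_mulSingle (i : ι) :
    Adj K.basePoint.1 ((Pi.mulSingle i (-1) : ι → ℤˣ) • K.basePoint.1) :=
  (inCell_mulSingle (simplex_singleton i) (Finset.mem_singleton_self i)).adj

lemma units_mul_self (ε : ι → ℤˣ) : ε * ε = 1 := funext fun i => Int.units_mul_self (ε i)

lemma liftSign_mul_self {J : Finset ι} {ε : ι → ℤˣ}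
    (h : InCell J K.basePoint.1 (ε • K.basePoint.1)) :
    liftSign h.adj * liftSign h.adj = 1 := by
  have h1 : Adj K.basePoint.1 ((1 : ι → ℤˣ) • K.basePoint.1) := by
    rw [one_smul]
    exact h.refl.adj
  rw [liftSign_mul h h (by rwa [units_mul_self]), liftSign_congr _ (units_mul_self ε) h1,
    liftSign_one]

open Classical in
variable (K) in
/-- The action of `W_K` on the classes of based paths. -/
def pathAction : K.W →* Function.End K.BasedPath :=
  K.coxeterMatrix.toCoxeterSystem.lift ⟨fun i => liftSign (adj_mulSingle i), by
    intro i j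
    change (liftSign (adj_mulSingle i) * liftSign (adj_mulSingle j)) ^
      (if i = j then 1 else if {i, j} ∈ K.faces then 2 else 0) = 1
    by_cases h : i = j
    · subst h
      rw [if_pos rfl, pow_one]
      exact liftSign_mul_self (inCell_mulSingle (simplex_singleton i) (by simp))
    by_cases h' : {i, j} ∈ K.faces
    · have hc : InCell {i, j} K.basePoint.1
          ((Pi.mulSingle i (-1) * Pi.mulSingle j (-1) : ι → ℤˣ) • K.basePoint.1) :=
        inCell_basePoint_smul (.inr h') fun k hk => by
          simp only [Finset.mem_insert, Finset.mem_singleton, not_or] at hk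
          rw [Pi.mul_apply, Pi.mulSingle_eq_of_ne hk.1, Pi.mulSingle_eq_of_ne hk.2, one_mul]
      have key := liftSign_mul (inCell_mulSingle (.inr h') (by simp))
        (inCell_mulSingle (.inr h') (by simp)) hc.adj
      rw [if_neg h, if_pos h', key, pow_two]
      exact liftSign_mul_self hc
    · rw [if_neg h, if_neg h', pow_zero]⟩

lemma W.induction {p : K.W → Prop} (w : K.W) (one : p 1)
    (simple_mul : ∀ w i, p w → p (K.coxeterMatrix.simple i * w)) : p w :=
  K.coxeterMatrix.toCoxeterSystem.simple_induction_left w one simple_mul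

open Classical in
lemma pathAction_simple (i : ι) (p : K.BasedPath) :
    K.pathAction (K.coxeterMatrix.simple i) p = liftSign (adj_mulSingle i) p :=
  congrFun (K.coxeterMatrix.toCoxeterSystem.lift_apply_simple (G := Function.End K.BasedPath) _ i) p

lemma pathAction_mul (w w' : K.W) (p : K.BasedPath) :
    K.pathAction (w * w') p = K.pathAction w (K.pathAction w' p) :=
  congrFun (map_mul K.pathAction w w') p

lemma pathAction_one (p : K.BasedPath) : K.pathAction 1 p = p :=
  congrFun (map_one K.pathAction) p

lemma pathAction_fst (w : K.W) (p : K.BasedPath) :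
    (K.pathAction w p).1 = K.signHom w • p.1 := by
  induction w using W.induction with
  | one => rw [pathAction_one, map_one, one_smul]
  | simple_mul w i ih =>
    rw [pathAction_mul, pathAction_simple, map_mul, mul_smul, ← ih, signHom_simple]
    rfl

/-- The path `q` is the prolongation of the path `p` by a straight path. -/
def Prolongs (p q : K.BasedPath) : Prop := ∃ h : Adj p.1 q.1, q.2 = p.2.trans h.str

/-- The group changes the beginning of a path and reflects the rest, so it commutes with
prolongation at the end. -/
lemma Prolongs.pathAction {p q : K.BasedPath} (h : Prolongs p q) (w : K.W) :
    Prolongs (K.pathAction w p) (K.pathAction w q) := by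
  induction w using W.induction with
  | one => rwa [pathAction_one, pathAction_one]
  | simple_mul w i ih =>
    rw [pathAction_mul, pathAction_mul, pathAction_simple, pathAction_simple]
    obtain ⟨hadj, e⟩ := ih
    refine ⟨hadj.smul _, ?_⟩
    simp only [liftSign]
    rw [e, signMap_trans, signMap_str, Path.Homotopic.Quotient.trans_assoc]

/-- The straight path from the base point to a point of the chamber. -/
def chamberPath (x : K.Chamber) : K.BasedPath := ⟨x.1, Adj.str (exists_inCell_basePoint x)⟩

/-- As `xᵢ = 0`, the vertex `i` lies in the simplex of any cube containing `b` and `x`. That cube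
also contains the reflected path, which still ends at `x`. This makes the canonical class well
defined on `U`. -/
lemma pathAction_simple_chamberPath {i : ι} {x : K.Chamber} (h : x ∈ K.mirror i) :
    K.pathAction (K.coxeterMatrix.simple i) (chamberPath x) = chamberPath x := by
  classical
  rw [pathAction_simple]
  obtain ⟨J, hJ⟩ := exists_inCell_basePoint x
  have hi : i ∈ J := by
    by_contra hi
    have h1 : x.1.1 i = 1 := (hJ.2 i hi).2
    have h0 : x.1.1 i = 0 := h
    rw [h0] at h1
    norm_num at h1
  have hfix : (Pi.mulSingle i (-1) : ι → ℤˣ) • x.1 = x.1 := by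
    have := K.signHom_smul_eq (Subgroup.subset_closure (mem_image_of_mem _ h))
    rwa [signHom_simple] at this
  have h1 := inCell_mulSingle hJ.1 hi
  have h2 := hJ.smul (Pi.mulSingle i (-1))
  have h3 : (adj_mulSingle i).str.trans (signMap (Pi.mulSingle i (-1)) hJ.adj.str) =
      (h1.trans h2).adj.str := by
    rw [signMap_str]
    exact h1.str_trans (h1.trans h2) _ _ _
  exact Sigma.ext hfix ((heq_of_eq h3).trans (Adj.heq_str _ _ hfix))

lemma pathAction_chamberPath {x : K.Chamber} {v : K.W}
    (hv : v ∈ Subgroup.closure (K.coxeterMatrix.simple '' {i | x ∈ K.mirror i})) :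
    K.pathAction v (chamberPath x) = chamberPath x := by
  induction hv using Subgroup.closure_induction with
  | mem _ h =>
    obtain ⟨i, hi, rfl⟩ := h
    exact pathAction_simple_chamberPath hi
  | one => exact pathAction_one _
  | mul v w _ _ hv hw => rw [pathAction_mul, hw, hv]
  | inv v _ hv =>
    conv_lhs => rw [← hv, ← pathAction_mul, inv_mul_cancel, pathAction_one]

/-- The canonical class of paths to the image of a point of `U(W_K, K(K))`. -/
def basedPath : K.U → K.BasedPath :=
  _root_.Quotient.lift (fun a => K.pathAction a.1 (chamberPath a.2)) (by
    rintro ⟨w, x⟩ ⟨w', x'⟩ ⟨h, h'⟩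
    dsimp only at h h'
    subst h
    have := pathAction_chamberPath h'
    dsimp only
    conv_lhs => rw [← this, ← pathAction_mul, mul_inv_cancel_left])

lemma basedPath_mk (w : K.W) (x : K.Chamber) :
    basedPath (pt w x) = K.pathAction w (chamberPath x) := rfl

lemma basedPath_fst (u : K.U) : (basedPath u).1 = K.proj u := by
  induction u using CoxeterMatrix.BasicConstruction.ind with | h w x =>
  exact pathAction_fst w _

/-- The canonical class of paths to the image of a point of `U(W_K, K(K))`, with the
endpoint fixed. -/
def pathClass (u : K.U) : Quotient K.basePoint.1 (K.proj u) :=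
  (basedPath u).2.cast rfl (basedPath_fst u).symm

lemma basedPath_eq (u : K.U) : basedPath u = ⟨K.proj u, pathClass u⟩ :=
  Sigma.ext (basedPath_fst u) (Path.Homotopic.Quotient.cast_heq _ _).symm

lemma pathClass_eq {u u' : K.U} (h : Prolongs (basedPath u) (basedPath u')) :
    ∃ h : Adj (K.proj u) (K.proj u'), pathClass u' = (pathClass u).trans h.str := by
  rwa [basedPath_eq, basedPath_eq] at h

lemma joined_basePoint (w : K.W) (x : K.Chamber) : Joined (pt w x) (pt w K.basePoint) := by
  have h : Joined K.basePoint x := by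
    have hx : Adj K.basePoint.1 x.1 := exists_inCell_basePoint x
    exact ⟨{
      toFun := fun t => ⟨hx.path t, fun i => by
        rw [Adj.coe_path, AffineMap.pi_lineMap_apply]
        exact lineMap_mem_Icc (K.basePoint.2 i) (x.2 i) t.2⟩
      continuous_toFun := by fun_prop
      source' := by simp
      target' := by simp }⟩
  exact (h.map (continuous_mk w)).symm

variable (K) in
lemma exists_mem_mirror (i : ι) : ∃ x : K.Chamber, x ∈ K.mirror i := by
  classical
  refine ⟨⟨⟨fun j => if j = i then 0 else 1, {i}, .inr (K.singleton_mem i), fun j _ => ?_,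
    fun j hj => .inr ?_⟩, fun j => ?_⟩, ?_⟩
  · dsimp only
    split_ifs <;> norm_num
  · simpa using hj
  · dsimp only
    split_ifs <;> norm_num
  · simp [mirror]

instance : PathConnectedSpace K.U := by
  have key : ∀ w : K.W, Joined (pt 1 K.basePoint) (pt w K.basePoint) := fun w => by
    refine K.coxeterMatrix.toCoxeterSystem.simple_induction_right
      (p := fun w => Joined (pt 1 K.basePoint) (pt w K.basePoint)) w (Joined.refl _)
      fun (w : K.W) i ih => ih.trans ?_
    obtain ⟨m, hm⟩ := exists_mem_mirror K i
    -- The chambers of `w` and `wsᵢ` are glued along the `i`-th mirror, which is nonempty.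
    have e : pt w m = pt (w * K.coxeterMatrix.simple i) m := mk_eq_mk.2 ⟨rfl, by
      rw [inv_mul_cancel_left]
      exact Subgroup.subset_closure (mem_image_of_mem _ hm)⟩
    have h1 := (joined_basePoint w m).symm
    rw [e] at h1
    exact h1.trans (joined_basePoint _ m)
  have key' : ∀ u : K.U, Joined (pt 1 K.basePoint) u := fun u => by
    induction u using CoxeterMatrix.BasicConstruction.ind with | h w x =>
    exact (key w).trans (joined_basePoint w x).symm
  exact ⟨⟨pt 1 K.basePoint⟩, fun u u' => (key' u).symm.trans (key' u')⟩

/-- The map induced by the projection on homotopy classes of paths. -/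
def projMap {u u' : K.U} (p : Quotient u u') : Quotient (K.proj u) (K.proj u') :=
  p.map ⟨K.proj, continuous_proj⟩

lemma projMap_trans {a b c : K.U} (p : Quotient a b) (q : Quotient b c) :
    projMap (p.trans q) = (projMap p).trans (projMap q) :=
  Path.Homotopic.Quotient.map_trans p q _

variable [Finite ι]

lemma eventually_prolongs (u : K.U) : ∃ V ∈ 𝓝 u, ∀ u' ∈ V, K.proj u' ∈ star (K.proj u) ∧
    Prolongs (basedPath u) (basedPath u') := by
  induction u using CoxeterMatrix.BasicConstruction.ind with | h w x =>
  refine ⟨nhd w x ∩ K.proj ⁻¹' star (K.proj (pt w x)), (((isOpen_nhd w x).inter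
    ((isOpen_star _).preimage continuous_proj)).mem_nhds ⟨mk_mem_nhd w x, self_mem_star _⟩),
    fun u' hu' => ⟨hu'.2, ?_⟩⟩
  obtain ⟨⟨v, hv, y, hy, rfl⟩, hs⟩ := hu'
  have hfix := K.signHom_smul_eq hv
  rw [mem_preimage, proj_mk, proj_mk] at hs
  obtain ⟨J, hJ⟩ := exists_inCell_of_mem_star hs
  have hJ' : InCell J x.1 y.1 := by
    have := hJ.smul (K.signHom (w * v))⁻¹
    rwa [inv_smul_smul, map_mul, mul_inv_rev, mul_smul, inv_smul_smul, inv_smul_eq_iff.2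
      hfix.symm] at this
  -- Since `v` fixes the chamber path of `x`, both classes are translates by `wv`; by equivariance
  -- only the chamber points `x` and `y` have to be compared.
  rw [basedPath_mk, basedPath_mk, ← pathAction_chamberPath hv, ← pathAction_mul]
  refine Prolongs.pathAction ⟨hJ'.adj, ?_⟩ _
  exact (hJ'.basePoint.str_trans (hJ'.basePoint.trans hJ') _ _ _).symm

/-- The canonical class of paths is the class of the image of every path. -/
lemma pathClass_trans {u u' : K.U} (p : Path u u') : pathClass u' =
    (pathClass u).trans (projMap (.mk p)) := by
  refine Path.induction_of_local (fun a b q => pathClass b =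
    (pathClass a).trans (projMap q)) ?_ ?_ p
  · intro a b c p q hp hq
    rw [hq, hp, projMap_trans, Path.Homotopic.Quotient.trans_assoc]
  · intro u
    obtain ⟨V, hV, h⟩ := eventually_prolongs u
    refine ⟨V, hV, fun a b p hp => ?_⟩
    obtain ⟨ha, ha'⟩ := pathClass_eq (h a (by simpa using hp 0)).2
    obtain ⟨hb, hb'⟩ := pathClass_eq (h b (by simpa using hp 1)).2
    rw [ha', hb', Path.Homotopic.Quotient.trans_assoc]
    -- The canonical classes at `a` and `b` both prolong the one at `u`, and the triangle with
    -- vertices at the images of `u`, `a`, `b` is filled inside the star.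
    congr 1
    exact (str_trans_of_mem_star ha hb _ fun t => (h _ (hp t)).1).symm

instance : SimplyConnectedSpace K.U := by
  refine simply_connected_iff_paths_homotopic'.2 ⟨inferInstance, fun p q => ?_⟩
  refine Path.Homotopic.Quotient.eq.1 (isCoveringMap_proj.injective_path_homotopic_map _ _ ?_)
  exact Path.Homotopic.Quotient.trans_left_cancel
    ((pathClass_trans p).symm.trans (pathClass_trans q))

end AbstractSimplicialComplex

/-! ### Uniqueness of the universal cover and lifts of the sign changes -/

lemma IsLocalHomeomorph.locallyPathConnectedSpace {E X : Type*} [TopologicalSpace E]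
    [TopologicalSpace X] [LocallyPathConnectedSpace X] {f : E → X} (hf : IsLocalHomeomorph f) :
    LocallyPathConnectedSpace E := by
  let _ : ChartedSpace X E :=
    { atlas := univ
      chartAt := fun e => (hf e).choose
      mem_chart_source := fun e => (hf e).choose_spec.1
      chart_mem_atlas := fun _ => mem_univ _ }
  exact ChartedSpace.locallyPathConnectedSpace X E

/-- Two simply connected covering spaces of a locally path-connected space are isomorphic. -/
lemma IsCoveringMap.exists_homeomorph {E F X : Type*} [TopologicalSpace E] [TopologicalSpace F]
    [TopologicalSpace X] [LocallyPathConnectedSpace X] [SimplyConnectedSpace E]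
    [SimplyConnectedSpace F] {p : E → X} {q : F → X} (hp : IsCoveringMap p)
    (hq : IsCoveringMap q) {e₀ : E} {f₀ : F} (h : p e₀ = q f₀) :
    ∃ Φ : E ≃ₜ F, ∀ e, q (Φ e) = p e := by
  have := hp.isLocalHomeomorph.locallyPathConnectedSpace
  have := hq.isLocalHomeomorph.locallyPathConnectedSpace
  obtain ⟨F, ⟨hF0, hF⟩, -⟩ := hq.existsUnique_continuousMap_lifts ⟨p, hp.continuous⟩ e₀ f₀ h.symm
  obtain ⟨G, ⟨hG0, hG⟩, -⟩ := hp.existsUnique_continuousMap_lifts ⟨q, hq.continuous⟩ f₀ e₀ h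
  have hF' : ∀ e, q (F e) = p e := fun e => congrFun hF e
  have hG' : ∀ f, p (G f) = q f := fun f => congrFun hG f
  refine ⟨{ toFun := F, invFun := G, left_inv := congrFun ?_, right_inv := congrFun ?_
            continuous_toFun := F.continuous, continuous_invFun := G.continuous }, hF'⟩
  · exact hp.eq_of_comp_eq (g₁ := fun e => G (F e)) (g₂ := id) (G.continuous.comp F.continuous)
      continuous_id (funext fun e => by simp [hG', hF']) e₀ (by simp [hF0, hG0])
  · exact hq.eq_of_comp_eq (g₁ := fun f => F (G f)) (g₂ := id) (F.continuous.comp G.continuous)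
      continuous_id (funext fun e => by simp [hG', hF']) f₀ (by simp [hF0, hG0])

namespace AbstractSimplicialComplex

variable {ι : Type u} {K : AbstractSimplicialComplex ι}

/-- The action of `W_K` by lifts of sign changes on a space over the real moment-angle complex that
is homeomorphic to `U(W_K, K(K))`. -/
def liftHom {E : Type v} [TopologicalSpace E] {p : E → K.realMomentAngle} (Φ : E ≃ₜ K.U)
    (hΦ : ∀ e, K.proj (Φ e) = p e) : K.W →* K.lifts p where
  toFun w := ⟨((Φ.trans (Homeomorph.smul w)).trans Φ.symm, K.signHom w), fun e => by
    change p (Φ.symm (w • Φ e)) = K.signHom w • p e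
    rw [← hΦ, ← hΦ, Φ.apply_symm_apply, proj_smul]⟩
  map_one' := Subtype.ext (Prod.ext (Homeomorph.ext fun e => by
    change Φ.symm ((1 : K.W) • Φ e) = e
    rw [one_smul, Φ.symm_apply_apply]) (map_one K.signHom))
  map_mul' w w' := Subtype.ext (Prod.ext (Homeomorph.ext fun e => by
    change Φ.symm ((w * w') • Φ e) = Φ.symm (w • Φ (Φ.symm (w' • Φ e)))
    rw [Φ.apply_symm_apply, mul_smul]) (map_mul K.signHom w w'))

lemma apply_liftHom {E : Type v} [TopologicalSpace E] {p : E → K.realMomentAngle} (Φ : E ≃ₜ K.U)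
    (hΦ : ∀ e, K.proj (Φ e) = p e) (w : K.W) (e : E) :
    Φ ((liftHom Φ hΦ w).1.1 e) = w • Φ e := Φ.apply_symm_apply _

/-- The base point lies on no mirror, so nothing is identified in its orbit. -/
lemma pt_basePoint_injective {w w' : K.W} (h : pt w K.basePoint = pt w' K.basePoint) :
    w = w' := by
  have h' := (mk_eq_mk.1 h).2
  have : {i | K.basePoint ∈ K.mirror i} = ∅ :=
    eq_empty_of_forall_notMem fun i (hi : (1 : ℝ) = 0) => one_ne_zero hi
  rw [this, image_empty, Subgroup.closure_empty, Subgroup.mem_bot] at h'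
  exact inv_mul_eq_one.1 h'

lemma eq_pt_of_proj_eq {u : K.U} {ε : ι → ℤˣ} (h : K.proj u = ε • K.basePoint.1) :
    ∃ w, u = pt w K.basePoint ∧ K.signHom w = ε := by
  induction u using CoxeterMatrix.BasicConstruction.ind with | h w x =>
  rw [proj_mk, ← inv_smul_eq_iff, ← mul_smul] at h
  have h' : (ε⁻¹ * K.signHom w)⁻¹ • K.basePoint.1 = x.1 := by rw [inv_smul_eq_iff, h]
  obtain ⟨rfl, hi⟩ := eq_of_smul_eq h'
  refine ⟨w, rfl, ?_⟩
  have : (ε⁻¹ * K.signHom w)⁻¹ = 1 := funext fun i => hi i (one_ne_zero (α := ℝ))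
  rw [inv_eq_one, inv_mul_eq_one] at this
  exact this.symm

/-- A lift of a sign change is determined by its value at one point. Over the base point, the
possible values are the `[w, b]`, each attained by the action of `w`. -/
lemma bijective_liftHom {E : Type v} [TopologicalSpace E] [PreconnectedSpace E]
    {p : E → K.realMomentAngle} (hp : IsCoveringMap p) (Φ : E ≃ₜ K.U)
    (hΦ : ∀ e, K.proj (Φ e) = p e) : Function.Bijective (liftHom Φ hΦ) := by
  refine ⟨fun w w' h => ?_, fun ⟨⟨h, ε⟩, hε⟩ => ?_⟩
  · have h1 := apply_liftHom Φ hΦ w (Φ.symm (pt 1 K.basePoint))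
    rw [h, apply_liftHom, Φ.apply_symm_apply, smul_mk, smul_mk, mul_one, mul_one] at h1
    exact (pt_basePoint_injective h1).symm
  · have hε' : ∀ e, p (h e) = ε • p e := hε
    obtain ⟨w, hw, rfl⟩ := eq_pt_of_proj_eq (K := K) (ε := ε)
      (u := Φ (h (Φ.symm (pt 1 K.basePoint)))) (by
        rw [hΦ, hε', ← hΦ, Φ.apply_symm_apply, proj_mk, map_one, one_smul])
    refine ⟨w, Subtype.ext (Prod.ext (Homeomorph.ext (congrFun ?_)) rfl)⟩
    refine hp.eq_of_comp_eq (Homeomorph.continuous _) h.continuous (funext fun e => ?_)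
      (Φ.symm (pt 1 K.basePoint)) (Φ.injective ?_)
    · exact ((liftHom Φ hΦ w).2 e).trans (hε' e).symm
    · rw [hw, apply_liftHom, Φ.apply_symm_apply, smul_mk, mul_one]

theorem exists_equivariant_homeomorph [Finite ι] {E : Type v} [TopologicalSpace E]
    [SimplyConnectedSpace E] {p : E → K.realMomentAngle} (hp : IsCoveringMap p) :
    ∃ (θ : K.W ≃* K.lifts p) (Φ : E ≃ₜ K.U), (∀ w, (θ w).1.2 = K.signHom w) ∧
      (∀ e, K.proj (Φ e) = p e) ∧ ∀ w e, Φ ((θ w).1.1 e) = w • Φ e := by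
  obtain ⟨e₀⟩ : Nonempty E := inferInstance
  obtain ⟨u₀, hu₀⟩ := surjective_proj (p e₀)
  obtain ⟨Φ, hΦ⟩ := hp.exists_homeomorph isCoveringMap_proj hu₀.symm
  exact ⟨MulEquiv.ofBijective _ (bijective_liftHom hp Φ hΦ), Φ, fun _ => rfl, hΦ,
    apply_liftHom Φ hΦ⟩

end AbstractSimplicialComplex

/-! ### Compactness of poset realizations and functoriality of the basic construction -/

lemma mem_posetRealization {P : Type u} [PartialOrder P] [Fintype P] {f : P → ℝ} :
    f ∈ posetRealization P ↔ (∀ p, 0 ≤ f p) ∧ ∑ p, f p = 1 ∧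
      ∀ p q, f p ≠ 0 → f q ≠ 0 → p ≤ q ∨ q ≤ p := by
  change (_ ∧ _ ∧ _) ↔ _
  rw [finsum_eq_sum_of_fintype]
  refine and_congr_right fun _ => and_congr_right fun _ => ⟨fun h p q hp hq => ?_,
    fun h p hp q hq _ => h p q hp hq⟩
  by_cases e : p = q
  · exact .inl e.le
  · exact h hp hq e

lemma isCompact_posetRealization (P : Type u) [PartialOrder P] [Finite P] :
    IsCompact (posetRealization P) := by
  have := Fintype.ofFinite P
  have hsub : posetRealization P ⊆ univ.pi fun _ => Icc (0 : ℝ) 1 := fun f hf p _ => by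
    obtain ⟨h0, h1, -⟩ := mem_posetRealization.1 hf
    exact ⟨h0 p, h1 ▸ Finset.single_le_sum (fun q _ => h0 q) (Finset.mem_univ p)⟩
  refine (isCompact_univ_pi fun _ => isCompact_Icc).of_isClosed_subset ?_ hsub
  have : posetRealization P = (⋂ p, {f | 0 ≤ f p}) ∩ ({f | ∑ p, f p = 1} ∩
      ⋂ p, ⋂ q, {f | f p = 0 ∨ f q = 0 ∨ p ≤ q ∨ q ≤ p}) := by
    ext f
    rw [mem_posetRealization]
    simp only [mem_inter_iff, mem_iInter, mem_ofPred_eq]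
    refine and_congr_right fun _ => and_congr_right fun _ =>
      forall_congr' fun p => forall_congr' fun q => ?_
    tauto
  rw [this]
  refine (isClosed_iInter fun p => isClosed_le continuous_const (continuous_apply p)).inter
    ((isClosed_eq (by fun_prop) continuous_const).inter
      (isClosed_iInter fun p => isClosed_iInter fun q => ?_))
  exact (isClosed_eq (continuous_apply p) continuous_const).union
    ((isClosed_eq (continuous_apply q) continuous_const).union isClosed_const)

namespace CoxeterMatrix.BasicConstruction

variable {B : Type u} {M : CoxeterMatrix B} {X Y : Type*} [TopologicalSpace X]
  [TopologicalSpace Y] {m : B → Set X} {m' : B → Set Y}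

variable (M) in
/-- A map of spaces that preserves the mirrors induces a map of basic constructions. -/
def map (f : X → Y) (h : ∀ i x, x ∈ m i ↔ f x ∈ m' i) :
    M.BasicConstruction m → M.BasicConstruction m' :=
  Quotient.map (fun a => (a.1, f a.2)) (by
    rintro ⟨w, x⟩ ⟨w', x'⟩ ⟨e, e'⟩
    refine ⟨congrArg f e, ?_⟩
    simpa only [← h] using e')

variable (M) in
/-- A homeomorphism that preserves the mirrors induces a homeomorphism of basic constructions. -/
def congr (f : X ≃ₜ Y) (h : ∀ i x, x ∈ m i ↔ f x ∈ m' i) :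
    M.BasicConstruction m ≃ₜ M.BasicConstruction m' where
  toFun := map M f h
  invFun := map M f.symm fun i y => by rw [h, f.apply_symm_apply]
  left_inv u := by
    induction u using ind with | h w x =>
    exact congrArg (mk M m w) (f.symm_apply_apply x)
  right_inv u := by
    induction u using ind with | h w x =>
    exact congrArg (mk M m' w) (f.apply_symm_apply x)
  continuous_toFun := continuous_iff.2 fun w => (continuous_mk w).comp f.continuous
  continuous_invFun := continuous_iff.2 fun w => (continuous_mk w).comp f.symm.continuous

end CoxeterMatrix.BasicConstruction

/-! ### Spherical subsets and simplices -/

namespace AbstractSimplicialComplex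

variable {ι : Type u} {K : AbstractSimplicialComplex ι}

open Classical in
/-- The product of two generators that do not span an edge has infinite order. -/
lemma simple_mul_simple_pow_ne_one {i j : ι} (h : i ≠ j) (h' : {i, j} ∉ K.faces) {n : ℕ}
    (hn : n ≠ 0) : (K.coxeterMatrix.simple i * K.coxeterMatrix.simple j) ^ n ≠ 1 := by
  let f : ι → DihedralGroup 0 := fun k => if k = i then .sr 0 else if k = j then .sr 1 else 1
  have hf : K.coxeterMatrix.IsLiftable f := by
    intro k l
    change (f k * f l) ^ (if k = l then 1 else if {k, l} ∈ K.faces then 2 else 0) = 1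
    have hself : ∀ k, f k * f k = 1 := fun k => by
      simp only [f]
      split_ifs <;> simp
    by_cases hkl : k = l
    · subst hkl
      simp [hself]
    by_cases hface : {k, l} ∈ K.faces
    · rw [if_neg hkl, if_pos hface, pow_two]
      have : f k = 1 ∨ f l = 1 := by
        by_contra! hcon
        have hk : k = i ∨ k = j := by
          by_contra! hk
          exact hcon.1 (by simp [f, hk])
        have hl : l = i ∨ l = j := by
          by_contra! hl
          exact hcon.2 (by simp [f, hl])
        rcases hk with rfl | rfl <;> rcases hl with rfl | rfl
        · exact hkl rfl
        · exact h' hface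
        · exact h' (by rwa [Finset.pair_comm])
        · exact hkl rfl
      rcases this with e | e <;> simp [e, hself]
    · rw [if_neg hkl, if_neg hface, pow_zero]
  intro hcon
  have hi := K.coxeterMatrix.toCoxeterSystem.lift_apply_simple hf i
  have hj := K.coxeterMatrix.toCoxeterSystem.lift_apply_simple hf j
  have := congrArg (K.coxeterMatrix.toCoxeterSystem.lift ⟨f, hf⟩) hcon
  rw [map_pow, map_mul, map_one] at this
  rw [CoxeterMatrix.toCoxeterSystem_simple] at hi hj
  rw [hi, hj] at this
  have hij : f i * f j = .r 1 := by simp [f, h.symm]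
  rw [hij, DihedralGroup.r_one_pow, DihedralGroup.one_def] at this
  have := DihedralGroup.r.inj this
  exact hn (by exact_mod_cast (this : ((n : ℤ) = 0)))

/-- In a finite group every `sᵢsⱼ` has finite order, so all pairs in `T` are edges and flagness
applies. -/
lemma IsFlag.simplex_of_finite (hK : K.IsFlag) {T : Finset ι}
    (hT : Finite (Subgroup.closure (K.coxeterMatrix.simple '' (T : Set ι)))) : K.Simplex T := by
  classical
  rcases T.eq_empty_or_nonempty with h | h
  · exact .inl h
  refine .inr (hK T h fun i hi j hj hij => ?_)
  by_contra hface
  have hmem : ∀ k ∈ T, K.coxeterMatrix.simple k ∈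
      Subgroup.closure (K.coxeterMatrix.simple '' (T : Set ι)) := fun k hk =>
    Subgroup.subset_closure (mem_image_of_mem _ hk)
  let g : Subgroup.closure (K.coxeterMatrix.simple '' (T : Set ι)) :=
    ⟨_, mul_mem (hmem i hi) (hmem j hj)⟩
  have hg := congrArg Subtype.val (pow_orderOf_eq_one g)
  refine simple_mul_simple_pow_ne_one hij (fun hc => hface ?_) (orderOf_pos g).ne' hg
  convert hc

variable [Finite ι]

lemma Simplex.finite_closure {J : Finset ι} (hJ : K.Simplex J) :
    Finite (Subgroup.closure (K.coxeterMatrix.simple '' (J : Set ι))) := by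
  refine Finite.of_injective (fun g => K.signHom g.1) fun g g' h => ?_
  have := hJ.eq_one_of_signHom_eq_one subset_rfl (mul_mem g.2 (inv_mem g'.2)) (by
    rw [map_mul, map_inv, mul_inv_eq_one]
    exact h)
  exact Subtype.ext (mul_inv_eq_one.1 this)

end AbstractSimplicialComplex

/-! ### The cubical chamber of a flag complex as the Davis chamber -/

namespace AbstractSimplicialComplex

open MeasureTheory

variable {ι : Type u} {K : AbstractSimplicialComplex ι}

section Level

variable [Finite ι]

open Classical in
/-- The spherical subset of the vertices `i` with `xᵢ ≤ 1 - t`. -/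
def level (x : K.Chamber) (t : ℝ) : K.coxeterMatrix.Spherical :=
  -- The condition `xᵢ < 1` is automatic for `t > 0`; it makes the set a simplex for the remaining
  -- `t` too.
  ⟨(Set.toFinite {i | x.1.1 i ≤ 1 - t ∧ x.1.1 i < 1}).toFinset, by
    obtain ⟨J, hJ⟩ := exists_inCell_basePoint x
    refine (hJ.1.mono fun i hi => ?_ : K.Simplex _).finite_closure
    rw [Set.Finite.mem_toFinset] at hi
    by_contra hiJ
    exact hi.2.ne (hJ.2 i hiJ).2⟩

lemma mem_level {x : K.Chamber} {t : ℝ} {i : ι} :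
    i ∈ (level x t).1 ↔ x.1.1 i ≤ 1 - t ∧ x.1.1 i < 1 :=
  Set.Finite.mem_toFinset _

lemma level_anti (x : K.Chamber) : Antitone (level x) := fun s t hst i hi => by
  rw [mem_level] at hi ⊢
  exact ⟨by linarith, hi.2⟩

lemma measurableSet_level (x : K.Chamber) (T : K.coxeterMatrix.Spherical) :
    MeasurableSet (level x ⁻¹' {T}) := by
  have : level x ⁻¹' {T} = ⋂ i, {t | i ∈ (level x t).1 ↔ i ∈ T.1} := by
    ext t
    simp only [mem_preimage, mem_singleton_iff, mem_iInter, mem_ofPred_eq, Subtype.ext_iff,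
      Finset.ext_iff]
  rw [this]
  refine MeasurableSet.iInter fun i => ?_
  simp only [mem_level]
  refine MeasurableSet.iff ?_ (.const _)
  exact (measurableSet_le measurable_const (measurable_const.sub measurable_id)).inter (.const _)

/-- The uniform measure on the unit interval. -/
abbrev unitMeasure : Measure ℝ := volume.restrict (Ioc 0 1)

/-- The barycentric coordinates of a point of the chamber. -/
def baryCoord (x : K.Chamber) (T : K.coxeterMatrix.Spherical) : ℝ :=
  unitMeasure.real (level x ⁻¹' {T})

end Level

variable [Fintype K.coxeterMatrix.Spherical]

open Classical in
/-- The coordinates of the point of the chamber with given barycentric coordinates. -/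
def cubeCoord (f : K.coxeterMatrix.Spherical → ℝ) (i : ι) : ℝ :=
  ∑ T, if i ∈ T.1 then 0 else f T

open Classical in
lemma one_sub_cubeCoord {f : K.coxeterMatrix.Spherical → ℝ} (h : ∑ T, f T = 1) (i : ι) :
    1 - cubeCoord f i = ∑ T, if i ∈ T.1 then f T else 0 := by
  rw [cubeCoord, ← h, ← Finset.sum_sub_distrib]
  refine Finset.sum_congr rfl fun T _ => ?_
  split_ifs <;> simp

lemma cubeCoord_mem_Icc {f : K.coxeterMatrix.Spherical → ℝ} (h0 : ∀ T, 0 ≤ f T)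
    (h1 : ∑ T, f T = 1) (i : ι) : cubeCoord f i ∈ Icc (0 : ℝ) 1 := by
  classical
  constructor
  · exact Finset.sum_nonneg fun T _ => by split_ifs <;> simp [h0]
  · have : 0 ≤ 1 - cubeCoord f i := by
      rw [one_sub_cubeCoord h1]
      exact Finset.sum_nonneg fun T _ => by split_ifs <;> simp [h0]
    linarith

variable [Finite ι]

lemma IsFlag.cubeCoord_mem (hK : K.IsFlag) {f : K.coxeterMatrix.Spherical → ℝ}
    (hf : f ∈ posetRealization K.coxeterMatrix.Spherical) :
    cubeCoord f ∈ K.realMomentAngle := by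
  classical
  obtain ⟨h0, h1, hc⟩ := mem_posetRealization.1 hf
  have hne : (Finset.univ.filter fun T => f T ≠ 0).Nonempty := by
    by_contra hcon
    rw [Finset.not_nonempty_iff_eq_empty, Finset.filter_eq_empty_iff] at hcon
    rw [Finset.sum_eq_zero fun T hT => not_not.1 (hcon hT)] at h1
    norm_num at h1
  -- The largest member `T` of the supporting chain gives the cube: for `i ∉ T` no member contains
  -- `i`, so the coordinate is the total mass `1`.
  obtain ⟨T, hT, hmax⟩ := Finset.exists_max_image _ (fun T => T.1.card) hne
  rw [Finset.mem_filter] at hT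
  refine ⟨T.1, hK.simplex_of_finite T.2, fun i _ => ?_, fun i hi => .inr ?_⟩
  · have := cubeCoord_mem_Icc h0 h1 i
    exact ⟨by linarith [this.1], this.2⟩
  · rw [← h1, cubeCoord]
    refine Finset.sum_congr rfl fun T' _ => ?_
    split_ifs with hi'
    · by_contra hT'
      have hT' : f T' ≠ 0 := fun e => hT' e.symm
      have hle : T' ≤ T := by
        rcases hc T T' hT.2 hT' with h | h
        · exact (Subtype.ext (Finset.eq_of_subset_of_card_le h (hmax T' (by simp [hT'])))).ge
        · exact h
      exact hi (hle hi')
    · rfl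

/-- The map from the Davis chamber to the cubical chamber. -/
def IsFlag.toChamber (hK : K.IsFlag) (f : K.coxeterMatrix.DavisChamber) : K.Chamber :=
  ⟨⟨cubeCoord f.1, hK.cubeCoord_mem f.2⟩, cubeCoord_mem_Icc (mem_posetRealization.1 f.2).1
    (mem_posetRealization.1 f.2).2.1⟩

lemma IsFlag.continuous_toChamber (hK : K.IsFlag) : Continuous hK.toChamber := by
  classical
  refine Continuous.subtype_mk (Continuous.subtype_mk (continuous_pi fun i => ?_) _) _
  refine continuous_finsetSum _ fun T _ => ?_
  split_ifs
  · exact continuous_const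
  · exact (continuous_apply T).comp continuous_subtype_val

lemma IsFlag.toChamber_mem_mirror (hK : K.IsFlag) (i : ι) (f : K.coxeterMatrix.DavisChamber) :
    hK.toChamber f ∈ K.mirror i ↔ f ∈ K.coxeterMatrix.davisMirror i := by
  classical
  have h0 := (mem_posetRealization.1 f.2).1
  change (∑ T, if i ∈ T.1 then 0 else f.1 T) = 0 ↔ ∀ T, f.1 T ≠ 0 → i ∈ T.1
  rw [Finset.sum_eq_zero_iff_of_nonneg fun T _ => by split_ifs <;> simp [h0]]
  refine ⟨fun h T hT => ?_, fun h T _ => ?_⟩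
  · by_contra hi
    have := h T (Finset.mem_univ T)
    rw [if_neg hi] at this
    exact hT this
  · split_ifs with hi
    · rfl
    · by_contra hT
      exact hi (h T hT)

lemma sum_baryCoord_filter (x : K.Chamber) (p : K.coxeterMatrix.Spherical → Prop)
    [DecidablePred p] :
    (∑ T, if p T then baryCoord x T else 0) = unitMeasure.real {t | p (level x t)} := by
  rw [← Finset.sum_filter]
  simp only [baryCoord]
  rw [sum_measureReal_preimage_singleton _ (fun T _ => measurableSet_level x T)]
  congr 1
  ext t
  simp

lemma sum_baryCoord (x : K.Chamber) : ∑ T, baryCoord x T = 1 := by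
  have := sum_baryCoord_filter x (fun _ => True)
  simpa using this

lemma baryCoord_mem (x : K.Chamber) :
    baryCoord x ∈ posetRealization K.coxeterMatrix.Spherical := by
  refine mem_posetRealization.2 ⟨fun T => measureReal_nonneg, sum_baryCoord x, ?_⟩
  have hne : ∀ T, baryCoord x T ≠ 0 → ∃ t, level x t = T := fun T hT => by
    by_contra! hcon
    refine hT ?_
    have : level x ⁻¹' {T} = ∅ := eq_empty_of_forall_notMem hcon
    rw [baryCoord, this, measureReal_empty]
  intro T T' hT hT'
  obtain ⟨t, rfl⟩ := hne T hT
  obtain ⟨t', rfl⟩ := hne T' hT'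
  exact (le_total t t').symm.imp (fun h => level_anti x h) fun h => level_anti x h

/-- Layer cake: `1 - xᵢ` is the length of the set of `t ∈ (0, 1]` whose level contains `i`. -/
lemma cubeCoord_baryCoord (x : K.Chamber) : cubeCoord (baryCoord x) = x.1.1 := by
  classical
  funext i
  have h := one_sub_cubeCoord (sum_baryCoord x) i
  rw [sum_baryCoord_filter x (fun T => i ∈ T.1)] at h
  have h' : unitMeasure.real {t | i ∈ (level x t).1} = 1 - x.1.1 i := by
    have hx := x.2 i
    simp only [mem_level]
    rw [measureReal_restrict_apply' measurableSet_Ioc]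
    have : {t | x.1.1 i ≤ 1 - t ∧ x.1.1 i < 1} ∩ Ioc 0 1 = Ioc 0 (1 - x.1.1 i) := by
      ext t
      simp only [mem_inter_iff, mem_ofPred_eq, mem_Ioc]
      constructor
      · rintro ⟨⟨h1, h2⟩, h3, h4⟩
        exact ⟨h3, by linarith⟩
      · rintro ⟨h1, h2⟩
        exact ⟨⟨by linarith, by linarith⟩, h1, by linarith [hx.1]⟩
    rw [this, Real.volume_real_Ioc_of_le (by linarith [hx.2]), sub_zero]
  linarith

/-- An inequality suffices for equality, since both families of coordinates sum to `1`. -/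
lemma IsFlag.le_baryCoord (hK : K.IsFlag) (f : K.coxeterMatrix.DavisChamber)
    (T : K.coxeterMatrix.Spherical) : f.1 T ≤ baryCoord (hK.toChamber f) T := by
  classical
  obtain ⟨h0, h1, hc⟩ := mem_posetRealization.1 f.2
  by_cases hT : f.1 T = 0
  · rw [hT]
    exact measureReal_nonneg
  -- As `t` grows the levels run down the chain: its members above `T` use up the length `a`, and
  -- `T` is the level on `(a, a + f T]`.
  set a : ℝ := ∑ T', if T < T' then f.1 T' else 0 with ha
  have ha0 : 0 ≤ a := Finset.sum_nonneg fun T' _ => by split_ifs <;> simp [h0]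
  have hpos : 0 < f.1 T := lt_of_le_of_ne (h0 T) (Ne.symm hT)
  have haT : a + f.1 T = ∑ T', if T ≤ T' then f.1 T' else 0 := by
    have : f.1 T = ∑ T', if T = T' then f.1 T' else 0 := by simp
    rw [this, ha, ← Finset.sum_add_distrib]
    refine Finset.sum_congr rfl fun T' _ => ?_
    by_cases e : T = T'
    · subst e; simp
    · simp [e, lt_iff_le_and_ne]
  have haT1 : a + f.1 T ≤ 1 := by
    rw [haT, ← h1]
    exact Finset.sum_le_sum fun T' _ => by split_ifs <;> simp [h0]
  have hin : ∀ i ∈ T.1, cubeCoord f.1 i ≤ 1 - (a + f.1 T) := fun i hi => by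
    have : a + f.1 T ≤ 1 - cubeCoord f.1 i := by
      rw [haT, one_sub_cubeCoord h1]
      refine Finset.sum_le_sum fun T' _ => ?_
      split_ifs with hle hi'
      · exact le_rfl
      · exact absurd (hle hi) hi'
      · exact h0 T'
      · exact le_rfl
    linarith
  have hout : ∀ i ∉ T.1, 1 - a ≤ cubeCoord f.1 i := fun i hi => by
    have : 1 - cubeCoord f.1 i ≤ a := by
      rw [one_sub_cubeCoord h1]
      refine Finset.sum_le_sum fun T' _ => ?_
      split_ifs with hi' hlt
      · exact le_rfl
      · refine le_of_eq (not_not.1 fun hT' => hlt ?_)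
        rcases hc T T' hT hT' with h | h
        · exact lt_of_le_of_ne h (by rintro rfl; exact hi hi')
        · exact absurd (h hi') hi
      · exact h0 T'
      · exact le_rfl
    linarith
  have hsub : Ioc a (a + f.1 T) ⊆ level (hK.toChamber f) ⁻¹' {T} ∩ Ioc 0 1 := by
    rintro t ⟨ht, ht'⟩
    refine ⟨Subtype.ext (Finset.ext fun i => ?_), by linarith, by linarith⟩
    rw [mem_level]
    change cubeCoord f.1 i ≤ 1 - t ∧ cubeCoord f.1 i < 1 ↔ i ∈ T.1
    constructor
    · rintro ⟨h, -⟩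
      by_contra hi
      linarith [hout i hi]
    · intro hi
      have := hin i hi
      exact ⟨by linarith, by linarith⟩
  calc f.1 T = volume.real (Ioc a (a + f.1 T)) := by
        rw [Real.volume_real_Ioc_of_le (by linarith)]
        ring
    _ ≤ volume.real (level (hK.toChamber f) ⁻¹' {T} ∩ Ioc 0 1) :=
        measureReal_mono hsub (measure_ne_top_of_subset inter_subset_right (by simp))
    _ = baryCoord (hK.toChamber f) T := (measureReal_restrict_apply' measurableSet_Ioc).symm

lemma IsFlag.baryCoord_toChamber (hK : K.IsFlag) (f : K.coxeterMatrix.DavisChamber) :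
    baryCoord (hK.toChamber f) = f.1 := by
  have h1 := (mem_posetRealization.1 f.2).2.1
  have := (Finset.sum_eq_sum_iff_of_le fun T _ => hK.le_baryCoord f T).1
    (h1.trans (sum_baryCoord _).symm)
  exact funext fun T => (this T (Finset.mem_univ T)).symm

/-- The cubical chamber of a flag complex is the Davis chamber. -/
def IsFlag.chamberHomeomorph (hK : K.IsFlag) : K.Chamber ≃ₜ K.coxeterMatrix.DavisChamber :=
  have : CompactSpace K.coxeterMatrix.DavisChamber :=
    isCompact_iff_compactSpace.1 (isCompact_posetRealization _)
  -- A continuous bijection from a compact to a Hausdorff space; continuity of the barycentric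
  -- coordinates comes for free.
  (Continuous.homeoOfEquivCompactToT2 (f :=
    { toFun := hK.toChamber
      invFun := fun x => ⟨baryCoord x, baryCoord_mem x⟩
      left_inv := fun f => Subtype.ext (hK.baryCoord_toChamber f)
      right_inv := fun x => Subtype.ext (Subtype.ext (cubeCoord_baryCoord x)) })
    hK.continuous_toChamber).symm

lemma IsFlag.mem_mirror_iff (hK : K.IsFlag) (i : ι) (x : K.Chamber) :
    x ∈ K.mirror i ↔ hK.chamberHomeomorph x ∈ K.coxeterMatrix.davisMirror i := by
  rw [← hK.toChamber_mem_mirror]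
  exact iff_of_eq (congrArg (· ∈ K.mirror i) (hK.chamberHomeomorph.symm_apply_apply x).symm)

end AbstractSimplicialComplex

end

theorem proposition3p1 {ι : Type u} [Finite ι] (K : AbstractSimplicialComplex ι) :
    -- `U(W_K, K(K))` is a universal cover of the real moment-angle complex
    (SimplyConnectedSpace K.U ∧ IsCoveringMap K.proj) ∧
    -- every universal cover `E` is equivariantly homeomorphic to it, over the complex,
    -- where `W_K` acts on `E` as the group of all lifts of the sign changes
    (∀ (E : Type v) [TopologicalSpace E] [SimplyConnectedSpace E]
      (p : E → K.realMomentAngle), IsCoveringMap p →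
        ∃ (θ : K.W ≃* K.lifts p) (Φ : E ≃ₜ K.U),
          (∀ w, (θ w).1.2 = K.signHom w) ∧
          (∀ e, K.proj (Φ e) = p e) ∧
          (∀ w e, Φ ((θ w).1.1 e) = w • Φ e)) ∧
    -- in the flag case it is the Davis complex of `W_K`
    (K.IsFlag → ∃ (f : K.Chamber ≃ₜ K.coxeterMatrix.DavisChamber)
        (F : K.U ≃ₜ K.coxeterMatrix.DavisComplex),
      (∀ i x, x ∈ K.mirror i ↔ f x ∈ K.coxeterMatrix.davisMirror i) ∧
      (∀ w x, F (CoxeterMatrix.BasicConstruction.mk _ _ w x) =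
        CoxeterMatrix.BasicConstruction.mk _ _ w (f x)) ∧
      (∀ (w : K.W) (u : K.U), F (w • u) = w • F u)) := by
  refine ⟨⟨inferInstance, AbstractSimplicialComplex.isCoveringMap_proj⟩,
    fun E _ _ p hp => AbstractSimplicialComplex.exists_equivariant_homeomorph hp,
    fun hK => ?_⟩
  have := Fintype.ofFinite K.coxeterMatrix.Spherical
  refine ⟨hK.chamberHomeomorph, CoxeterMatrix.BasicConstruction.congr _ hK.chamberHomeomorph
    hK.mem_mirror_iff, hK.mem_mirror_iff, fun w x => rfl, fun w u => ?_⟩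
  induction u using CoxeterMatrix.BasicConstruction.ind with | h w' x =>
  rfl
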